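/- Let $K$ be a field equipped with a henselian topology $\tau$, i.e. a ring topology that is locally equivalent to the topology induced by a nontrivial henselian valuation on some field $L$. (Here a topological ring is regarded as a two-sorted structure consisting of the ring and the filter of neighbourhoods of $0$; two topological rings are locally equivalent if they satisfy the same local sentences, that is, sentences of the language of rings with membership $t\in U$ in which quantifiers over neighbourhoods $U$ of $0$ are allowed in the form $\exists U\,\varphi$ only if $U$ occurs only negatively in $\varphi$, and in the form $\forall U\,\varphi$ only if $U$ occurs only positively in $\varphi$.) Let $B\subseteq K$ be any subset, and let $\mathbb{F}(B)$ be the subfield of $K$ generated by $B$ over the prime field $\mathbb{F}$. For a subfield $C\subseteq K$, let $\Lambda_K C$ denote the smallest subfield $D$ of $K$ that contains $C$ and for which $K/D$ is separable, meaning that $K$ and $D^{1/p}$ are linearly disjoint over $D$, where $p$ is the characteristic exponent of $K$. Let $\mathrm{acl}_\exists^K(B)$ be the union of the finite subsets of $K$ that are definable in $K$ by an existential formula of the language of rings with parameters from $B$, and let $\mathrm{dcl}_\exists^K(B)$ be the set of those $x\in K$ such that $\{x\}$ is definable in $K$ by such a formula. Then: (i) $\mathrm{dcl}_\exists^K(B)$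 contains $\Lambda_K\mathbb{F}(B)$ and is contained in the relative algebraic closure of $\Lambda_K\mathbb{F}(B)$ in $K$; (ii) $\mathrm{acl}_\exists^K(B)$ is equal to the relative algebraic closure of $\Lambda_K\mathbb{F}(B)$ in $K$. -/

import Mathlib

/-! ## Local formulas and local equivalence of topological rings -/

/-- Local formulas over the language of rings with a second sort for neighbourhoods of zero.

`LocalFormula n p q` is the type of formulas with `n` free element variables, and with `p + q` free
set variables: those among the first `p` occur only positively and those among the last `q` occur
only negatively.  Sets are quantified only by `∃ U`, with `U` occurring only negatively in the scope
(dually, by `∀ U = ¬ ∃ U ¬`, with `U` occurring only positively in the scope).  Ring terms in `n`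
variables are written as polynomials in `n` variables over `ℤ`; an equation of terms is written
`t = 0`. -/
inductive LocalFormula : ℕ → ℕ → ℕ → Type
  | eqZero {n p q : ℕ} (t : MvPolynomial (Fin n) ℤ) : LocalFormula n p q
  | mem {n p q : ℕ} (t : MvPolynomial (Fin n) ℤ) (i : Fin p) : LocalFormula n p q
  | neg {n p q : ℕ} (φ : LocalFormula n q p) : LocalFormula n p q
  | and {n p q : ℕ} (φ ψ : LocalFormula n p q) : LocalFormula n p q
  | exElem {n p q : ℕ} (φ : LocalFormula (n + 1) p q) : LocalFormula n p q
  | exSet {n p q : ℕ} (φ : LocalFormula n p (q + 1)) : LocalFormula n p q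

/-- Satisfaction of local formulas in a topological ring: element variables range over the ring, set
variables range over the neighbourhoods of zero. -/
def LocalFormula.Realize (K : Type*) [CommRing K] [TopologicalSpace K] :
    {n p q : ℕ} → LocalFormula n p q → (Fin n → K) → (Fin p → Set K) → (Fin q → Set K) → Prop
  | _, _, _, .eqZero t, v, _, _ => MvPolynomial.aeval v t = 0
  | _, _, _, .mem t i, v, P, _ => MvPolynomial.aeval v t ∈ P i
  | _, _, _, .neg φ, v, P, N => ¬ φ.Realize K v N P
  | _, _, _, .and φ ψ, v, P, N => φ.Realize K v P N ∧ ψ.Realize K v P N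
  | _, _, _, .exElem φ, v, P, N => ∃ x : K, φ.Realize K (Fin.snoc v x) P N
  | _, _, _, .exSet φ, v, P, N => ∃ U ∈ nhds (0 : K), φ.Realize K v P (Fin.snoc N U)

/-- Local equivalence: the same local sentences hold. -/
def LocallyEquivalent (K L : Type*) [CommRing K] [TopologicalSpace K]
    [CommRing L] [TopologicalSpace L] : Prop :=
  ∀ φ : LocalFormula 0 0 0,
    φ.Realize K Fin.elim0 Fin.elim0 Fin.elim0 ↔ φ.Realize L Fin.elim0 Fin.elim0 Fin.elim0

/-- The topology on a field induced by (the valuation of) a valuation ring. -/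
noncomputable abbrev ValuationSubring.valuationTopology {L : Type*} [Field L]
    (A : ValuationSubring L) : TopologicalSpace L :=
  (Valued.mk' A.valuation).toUniformSpace.toTopologicalSpace

/-- A henselian topology on a field: a ring topology which is locally equivalent to the topology
induced by some nontrivial henselian valuation on some field. -/
def IsHenselianTopology.{u} {K : Type u} [Field K] (τ : TopologicalSpace K) : Prop :=
  IsTopologicalRing K ∧
    ∃ (L : Type u) (_ : Field L) (A : ValuationSubring L),
      A ≠ ⊤ ∧ HenselianLocalRing A ∧
        @LocallyEquivalent K L _ τ _ A.valuationTopology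

/-! ## Separable extensions and the Lambda closure -/

section Lambda

variable {K : Type*} [Field K]

/-- The field `D^(1/p)` of `p`-th roots, in the algebraic closure of `K`, of elements of `D ⊆ K`,
where `p` is the characteristic exponent of `K`. -/
noncomputable def Subfield.pthRoots (D : Subfield K) : IntermediateField D (AlgebraicClosure K) where
  carrier := {x | ∃ d : D, x ^ ringExpChar K = algebraMap D (AlgebraicClosure K) d}
  mul_mem' := by
    rintro a b ⟨d, hd⟩ ⟨e, he⟩
    exact ⟨d * e, by rw [mul_pow, hd, he, map_mul]⟩
  add_mem' := by
    rintro a b ⟨d, hd⟩ ⟨e, he⟩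
    have : ExpChar (AlgebraicClosure K) (ringExpChar K) :=
      expChar_of_injective_algebraMap (algebraMap K (AlgebraicClosure K)).injective _
    exact ⟨d + e, by rw [add_pow_expChar, hd, he, map_add]⟩
  algebraMap_mem' d := ⟨d ^ ringExpChar K, by rw [map_pow]⟩
  inv_mem' := by
    rintro a ⟨d, hd⟩
    exact ⟨d⁻¹, by rw [inv_pow, hd, map_inv₀]⟩

/-- The (not necessarily algebraic) extension `K / D` is separable: `K` and `D^(1/p)` are linearly
disjoint over `D`. -/
def Subfield.IsSeparableIn (D : Subfield K) : Prop :=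
  D.pthRoots.LinearDisjoint K

/-- `Λ_K C`: the smallest subfield `D` of `K` containing `C` such that `K / D` is separable. -/
noncomputable def lambdaClosure (C : Subfield K) : Subfield K :=
  sInf {D : Subfield K | C ≤ D ∧ D.IsSeparableIn}

/-- `K / D` is separable iff elements of `D^(1/p)` which are linearly independent over `D` stay so
over `K`. -/
theorem Subfield.isSeparableIn_iff (D : Subfield K) :
    D.IsSeparableIn ↔ ∀ s : Finset (AlgebraicClosure K), (∀ x ∈ s, x ∈ D.pthRoots) →
      LinearIndepOn D id (s : Set (AlgebraicClosure K)) →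
        LinearIndepOn K id (s : Set (AlgebraicClosure K)) := by
  constructor
  · intro H s hs hD
    have hD' : LinearIndependent D (fun x : (s : Set (AlgebraicClosure K)) =>
        (⟨x.1, hs x.1 x.2⟩ : D.pthRoots)) :=
      LinearIndependent.of_comp D.pthRoots.val.toLinearMap hD
    exact H.linearIndependent_left hD'
  · intro H
    let b := Module.Free.chooseBasis D D.pthRoots
    refine IntermediateField.LinearDisjoint.of_basis_left b ?_
    have hb : LinearIndependent D (D.pthRoots.val ∘ b) :=
      b.linearIndependent.map' D.pthRoots.val.toLinearMap
        (LinearMap.ker_eq_bot.2 D.pthRoots.val.injective)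
    have hinj : Function.Injective (D.pthRoots.val ∘ b) := hb.injective
    rw [← linearIndepOn_id_range_iff hinj, linearIndepOn_iff_linearIndepOn_finset]
    intro t ht
    refine H t (fun x hx => ?_) (((linearIndepOn_id_range_iff hinj).2 hb).mono ht)
    obtain ⟨i, rfl⟩ := ht hx
    exact (b i).2

/-- `Λ_K C` is indeed the least subfield of `K` that contains `C` and over which `K` is
separable. -/
theorem isLeast_lambdaClosure (C : Subfield K) :
    IsLeast {D : Subfield K | C ≤ D ∧ D.IsSeparableIn} (lambdaClosure C) := by
  classical
  set S : Set (Subfield K) := {D : Subfield K | C ≤ D ∧ D.IsSeparableIn} with hS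
  refine ⟨⟨le_sInf fun D hD => hD.1, ?_⟩, fun D hD => sInf_le hD⟩
  rw [Subfield.isSeparableIn_iff]
  intro s
  induction s using Finset.induction_on with
  | empty => intro _ _; simp
  | insert a s has ih =>
    intro hs hD
    rw [Finset.coe_insert] at hD ⊢
    have has' : a ∉ (s : Set (AlgebraicClosure K)) := by simpa using has
    rw [linearIndepOn_id_insert has'] at hD ⊢
    have hsK := ih (fun x hx => hs x (Finset.mem_insert_of_mem hx)) hD.1
    refine ⟨hsK, fun haK => hD.2 ?_⟩
    obtain ⟨k, -, hk⟩ := Submodule.mem_span_finset.1 haK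
    have key : ∀ D ∈ S, ∀ x ∈ s, k x ∈ D := by
      intro D hDS x hx
      have hroots : ∀ y ∈ insert a s, y ∈ D.pthRoots := by
        intro y hy
        obtain ⟨d, hd⟩ := hs y hy
        exact ⟨⟨d, sInf_le hDS d.2⟩, hd⟩
      have hDs : LinearIndepOn D id (s : Set (AlgebraicClosure K)) :=
        LinearIndependent.restrict_scalars (R := D) (K := K)
          (by intro u v huv; simpa [Algebra.smul_def] using huv) hsK
      have haD : a ∈ Submodule.span D (s : Set (AlgebraicClosure K)) := by
        by_contra hcon
        have h1 := (Subfield.isSeparableIn_iff D).1 hDS.2 (insert a s) hroots (by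
          rw [Finset.coe_insert, linearIndepOn_id_insert has']
          exact ⟨hDs, hcon⟩)
        rw [Finset.coe_insert, linearIndepOn_id_insert has'] at h1
        exact h1.2 haK
      obtain ⟨e, -, he⟩ := Submodule.mem_span_finset.1 haD
      have h2 := linearIndepOn_finset_iff.1 hsK (fun y => k y - (e y : K)) (by
        simp only [sub_smul, Finset.sum_sub_distrib, id]
        rw [hk, ← he, sub_eq_zero]
        rfl) x hx
      rw [sub_eq_zero.1 h2]
      exact (e x).2
    refine Submodule.mem_span_finset'.2 ⟨fun x => ⟨k x.1, ?_⟩, ?_⟩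
    · exact Subfield.mem_sInf.2 fun D hDS => key D hDS x.1 x.2
    · conv_rhs => rw [← hk]
      exact Finset.sum_coe_sort s fun x => k x • x

end Lambda

/-! ## Existential algebraic and definable closure -/

section Existential

variable {K : Type*} [Field K]

/-- The subset `A` of `K` is defined in the field `K` by an existential formula of the language of
rings with parameters from `B`. -/
def ExistentiallyDefinable (B A : Set K) : Prop :=
  letI := FirstOrder.Ring.compatibleRingOfRing K
  ∃ φ : (FirstOrder.Language.ring.withConstants B).Formula (Fin 1),
    FirstOrder.Language.BoundedFormula.IsExistential φ ∧ A = {x : K | φ.Realize fun _ => x}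

/-- `acl_∃(B)`: the union of the finite sets that are existentially definable over `B`. -/
def existentialAcl (B : Set K) : Set K :=
  ⋃₀ {A : Set K | A.Finite ∧ ExistentiallyDefinable B A}

/-- `dcl_∃(B)`: the elements whose singleton is existentially definable over `B`. -/
def existentialDcl (B : Set K) : Set K :=
  {x : K | ExistentiallyDefinable B {x}}

end Existential

/-!
The topology enters only through a first-order property of the field `K`. A field with a nontrivial
henselian valuation is large (`IsLargeField`): by Hensel's lemma in Newton's form, a plane curve
`f(x, y) = 0` with a rational point at which `∂f/∂y ≠ 0` has infinitely many rational points
(`IsLargeField.of_henselian`). Largeness is expressed by sentences of the language of rings, which are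
particular local sentences, so it passes to `K` (`IsHenselianTopology.isLargeField`).

Existentially definable sets are treated as diophantine sets, that is, as projections of zero sets of
finite systems of polynomials (`existentiallyDefinable_iff_isDiophantine`).

The elements `x` with `{x}` existentially definable over `B` form a subfield containing `B`. The
extension of `K` over it is separable, because the coefficients in a linear relation between
independent `p`-th roots are determined by the `p`-th power of the relation
(`existentialDclSubfield_isSeparableIn`). Hence this subfield contains `Λ = Λ_K 𝔽(B)`, and an element
algebraic over `Λ` lies in the finite set of roots of a polynomial with definable coefficients
(`mem_existentialAcl_of_isAlgebraic`).

Conversely, let `x` lie in a finite set `A` that is existentially definable over `B`, and suppose that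
`x` is transcendental over `Λ`. Let `S` consist of `x`, the witnesses for `x ∈ A`, and the inverse of
`m(x)`, where the polynomial `m` over `Λ` kills the elements of `A` algebraic over `Λ`. As `K / Λ` is
separable, `Λ(S)` has a separating transcendence basis `t`, and `Λ(S) = Λ(t)(θ)`. Every homomorphism
over `Λ` from `Λ[S]` to `K` maps `x` to an element of `A` transcendental over `Λ`. By largeness,
infinitely many specialisations of `t` on each line through `t` extend to such homomorphisms, and by
the pigeonhole principle a nontrivial relation between `t` and `x` becomes a relation `G(u, a) = 0`
valid for all `u`, with a fixed `a ∈ A` transcendental over `Λ`; this is absurd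
(`IsLargeField.exists_subalgebra_algHom`).
-/

section

open Polynomial

/-! ### Large fields and Hensel's lemma -/

/-- A field `K` is large if every plane curve `f(x, y) = 0` over `K` with a rational point at which
`∂f/∂y ≠ 0` has rational points with infinitely many different abscissas. -/
def IsLargeField (K : Type*) [Field K] : Prop :=
  ∀ (f : K[X][X]) (a b : K), f.evalEval a b = 0 → f.derivative.evalEval a b ≠ 0 →
    {x : K | ∃ y, f.evalEval x y = 0}.Infinite

theorem IsLargeField.infinite {K : Type*} [Field K] (h : IsLargeField K) : Infinite K := by
  have := h X 0 0 (by simp [evalEval]) (by simp [evalEval])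
  exact Set.infinite_univ_iff.1 (this.mono (Set.subset_univ _))

/-- Newton's form of Hensel's lemma, for `d²m + dX + X²h(X)` with `m` in the maximal ideal. The
substitution `X = -dm / Z` turns it, up to a unit, into the monic polynomial
`Z ^ (N + 2) - Z ^ (N + 1) + m r(Z)`, which has `1` as a simple root modulo the maximal ideal. -/
theorem HenselianLocalRing.exists_root_of_mul_sq {A : Type*} [CommRing A] [HenselianLocalRing A]
    (h : A[X]) (d m : A) (hm : m ∈ IsLocalRing.maximalIdeal A) :
    ∃ y : A, (C (d ^ 2 * m) + C d * X + X ^ 2 * h).eval y = 0 := by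
  obtain ⟨N, hN⟩ : ∃ N, (h.comp (C (-(d * m)) * X)).natDegree ≤ N := ⟨_, le_rfl⟩
  set k : A[X] := h.comp (C (-(d * m)) * X) with hk
  set r := reflect N k
  have hr : r.natDegree ≤ N := (natDegree_reflect_le).trans (by simp [hN])
  set Q : A[X] := X ^ (N + 2) - X ^ (N + 1) + C m * r with hQ
  have hmonic : Q.Monic := by
    have e : Q = X ^ (N + 1 + 1) + (C m * r - X ^ (N + 1)) := by rw [hQ]; ring
    have hdeg : (C m * r - X ^ (N + 1)).degree ≤ ((N + 1 : ℕ) : WithBot ℕ) := by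
      refine (degree_sub_le _ _).trans (max_le ?_ (degree_X_pow_le _))
      exact degree_le_of_natDegree_le
        ((natDegree_C_mul_le _ _).trans (hr.trans (Nat.le_succ _)))
    rw [e]
    exact monic_X_pow_add (hdeg.trans_lt (by exact_mod_cast Nat.lt_succ_self (N + 1)))
  have h1 : Q.eval 1 ∈ IsLocalRing.maximalIdeal A := by
    simpa [hQ] using Ideal.mul_mem_right _ _ hm
  have h2 : IsUnit (Q.derivative.eval 1) := by
    have : Q.derivative.eval 1 = 1 + m * r.derivative.eval 1 := by
      simp [hQ]
    rw [this]
    have := Ideal.mul_mem_right (r.derivative.eval 1) _ hm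
    exact IsLocalRing.isUnit_of_mem_nonunits_one_sub_self _ (by simpa using this)
  obtain ⟨z, hz, hz1⟩ := HenselianLocalRing.is_henselian Q hmonic 1 h1 h2
  have hzu : IsUnit z := by
    refine IsLocalRing.isUnit_of_mem_nonunits_one_sub_self _ ?_
    have := neg_mem hz1
    rwa [neg_sub] at this
  obtain ⟨u, rfl⟩ := hzu
  let _ : Invertible (↑u⁻¹ : A) := (u⁻¹).invertible
  have hinv : ⅟ (↑u⁻¹ : A) = (u : A) := by simp
  have key := eval₂_reflect_mul_pow (RingHom.id A) (↑u⁻¹ : A) N k hN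
  rw [hinv] at key
  have key' : r.eval (u : A) * (↑u⁻¹ : A) ^ N = k.eval (↑u⁻¹ : A) := key
  refine ⟨-(d * m) * ↑u⁻¹, ?_⟩
  have hk' : k.eval (↑u⁻¹ : A) = h.eval (-(d * m) * ↑u⁻¹) := by simp [hk]
  have hu : (u : A) * ↑u⁻¹ = 1 := u.mul_inv
  have hu' : ∀ n, (u : A) ^ n * (↑u⁻¹ : A) ^ n = 1 := fun n => by rw [← mul_pow, hu, one_pow]
  rw [IsRoot, hQ] at hz
  simp only [eval_add, eval_sub, eval_pow, eval_X, eval_mul, eval_C] at hz ⊢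
  rw [← hk', ← key']
  have e := congrArg (fun t => d ^ 2 * m * (t * (↑u⁻¹ : A) ^ (N + 2))) hz
  simp only [zero_mul, mul_zero] at e
  have e1 := hu' (N + 2)
  have e2 := hu' (N + 1)
  have e3 : ((u : A) ^ (N + 2) - (u : A) ^ (N + 1) + m * r.eval (u : A)) * (↑u⁻¹ : A) ^ (N + 2)
      = 1 - ↑u⁻¹ + m * (↑u⁻¹) ^ 2 * (r.eval (u : A) * ↑u⁻¹ ^ N) := by
    linear_combination e1 - ↑u⁻¹ * e2
  rw [e3] at e
  linear_combination e

theorem IsLocalRing.infinite_maximalIdeal {A : Type*} [CommRing A] [IsDomain A] [IsLocalRing A]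
    (h : ¬ IsField A) : (IsLocalRing.maximalIdeal A : Set A).Infinite := by
  obtain ⟨x, hx, hx0⟩ := Submodule.exists_mem_ne_zero_of_ne_bot
    (mt IsLocalRing.isField_iff_maximalIdeal_eq.2 h)
  have hinj : Function.Injective fun n : ℕ => x ^ (n + 1) := by
    intro m n hmn
    by_contra hne
    wlog hlt : m < n generalizing m n
    · exact this hmn.symm (Ne.symm hne) (by omega)
    obtain ⟨k, rfl⟩ := Nat.exists_eq_add_of_lt hlt
    have h1 : x ^ (m + 1) * x ^ (k + 1) = x ^ (m + 1) * 1 := by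
      rw [← pow_add, mul_one]
      simpa [add_assoc, add_comm, add_left_comm] using hmn.symm
    have h2 := mul_left_cancel₀ (pow_ne_zero _ hx0) h1
    exact hx (IsUnit.of_pow_eq_one h2 (by omega))
  exact Set.infinite_of_injective_forall_mem hinj fun n =>
    Ideal.pow_mem_of_mem _ hx _ (Nat.succ_pos n)

/-- The implicit function theorem over a henselian local ring: if `G(0, 0) = 0` and
`c = ∂G/∂y(0, 0)`, then `G(x, y) = 0` is solvable in `y` for every `x ∈ c²𝔪`. -/
theorem HenselianLocalRing.exists_evalEval_eq_zero {A : Type*} [CommRing A] [HenselianLocalRing A]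
    (G : A[X][X]) (h0 : G.evalEval 0 0 = 0) (m : A) (hm : m ∈ IsLocalRing.maximalIdeal A) :
    ∃ y, G.evalEval (G.derivative.evalEval 0 0 ^ 2 * m) y = 0 := by
  set c := G.derivative.evalEval 0 0 with hc
  set t := c ^ 2 * m with ht
  set q := G.map (evalRingHom t) with hq
  have hG : ∀ i, t ∣ q.coeff i - (G.coeff i).eval 0 := fun i => by
    have := sub_dvd_eval_sub t 0 (G.coeff i)
    simpa [hq] using this
  have h0' : (G.coeff 0).eval 0 = 0 := by
    simpa [evalEval, ← coeff_zero_eq_eval_zero] using h0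
  have hc' : (G.coeff 1).eval 0 = c := by
    simp [hc, evalEval, ← coeff_zero_eq_eval_zero, coeff_derivative]
  obtain ⟨e, he⟩ := hG 0
  obtain ⟨e', he'⟩ := hG 1
  rw [h0', sub_zero] at he
  rw [hc', sub_eq_iff_eq_add] at he'
  have hu : IsUnit (1 + c * m * e') := by
    refine IsLocalRing.isUnit_of_mem_nonunits_one_sub_self _ ?_
    have : -(c * m * e') ∈ IsLocalRing.maximalIdeal A :=
      neg_mem (Ideal.mul_mem_right _ _ (Ideal.mul_mem_left _ _ hm))
    simpa using this
  obtain ⟨u, hu⟩ := hu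
  have hd : q.coeff 1 = c * u := by rw [he', hu, ht]; ring
  obtain ⟨y, hy⟩ := HenselianLocalRing.exists_root_of_mul_sq q.divX.divX (q.coeff 1)
    (↑u⁻¹ ^ 2 * m * e) (Ideal.mul_mem_right _ _ (Ideal.mul_mem_left _ _ hm))
  refine ⟨y, ?_⟩
  have e0 : q.coeff 1 ^ 2 * (↑u⁻¹ ^ 2 * m * e) = q.coeff 0 := by
    rw [he, hd, ht]
    have : (u : A) * ↑u⁻¹ = 1 := u.mul_inv
    linear_combination (c ^ 2 * m * e) * (u * ↑u⁻¹ + 1) * this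
  have e1 : q = C (q.coeff 0) + C (q.coeff 1) * X + X ^ 2 * q.divX.divX := by
    conv_lhs => rw [← divX_mul_X_add q, ← divX_mul_X_add q.divX]
    rw [coeff_divX]
    ring
  rw [e0, ← e1, hq] at hy
  rw [evalEval, ← hy, eval_map, ← coe_evalRingHom, ← eval₂_hom]
  simp

theorem Polynomial.exists_map_eq_C_C_mul {A L : Type*} [CommRing A] [IsDomain A] [Field L]
    [Algebra A L] [IsFractionRing A L] (f : L[X][X]) : ∃ (s : A) (G : A[X][X]), s ≠ 0 ∧
      G.map (mapRingHom (algebraMap A L)) = C (C (algebraMap A L s)) * f := by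
  induction f using Polynomial.induction_on' with
  | add p q hp hq =>
    obtain ⟨s, G, hs, hG⟩ := hp
    obtain ⟨t, H, ht, hH⟩ := hq
    refine ⟨s * t, C (C t) * G + C (C s) * H, mul_ne_zero hs ht, ?_⟩
    simp only [Polynomial.map_add, Polynomial.map_mul, hG, hH, map_C, coe_mapRingHom, map_mul]
    ring
  | monomial n p =>
    induction p using Polynomial.induction_on' with
    | add p q hp hq =>
      obtain ⟨s, G, hs, hG⟩ := hp
      obtain ⟨t, H, ht, hH⟩ := hq
      refine ⟨s * t, C (C t) * G + C (C s) * H, mul_ne_zero hs ht, ?_⟩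
      simp only [Polynomial.map_add, Polynomial.map_mul, hG, hH, map_C, coe_mapRingHom, map_mul,
        (monomial n).map_add]
      ring
    | monomial m a =>
      obtain ⟨r, s, hs, rfl⟩ := IsFractionRing.div_surjective (A := A) a
      refine ⟨s, monomial n (monomial m r), nonZeroDivisors.ne_zero hs, ?_⟩
      have : algebraMap A L s ≠ 0 := by
        simpa using nonZeroDivisors.ne_zero hs
      simp [C_mul_monomial, mul_div_cancel₀ _ this]

theorem IsLargeField.of_henselian {A L : Type*} [CommRing A] [IsDomain A] [HenselianLocalRing A]
    [Field L] [Algebra A L] [IsFractionRing A L] (hA : ¬ IsField A) : IsLargeField L := by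
  intro f a b hab hab'
  -- move the point `(a, b)` to the origin, then clear denominators
  set g : L[X][X] := (f.map (compRingHom (X + C a))).comp (X + C (C b)) with hg
  have hev : ∀ (f : L[X][X]) x y, ((f.map (compRingHom (X + C a))).comp (X + C (C b))).evalEval x y
      = f.evalEval (x + a) (y + b) := by
    intro f x y
    induction f using Polynomial.induction_on' with
    | add p q hp hq => simp_all [evalEval]
    | monomial n p => simp [evalEval, ← C_mul_X_pow_eq_monomial]
  obtain ⟨s, G, hs, hG⟩ := exists_map_eq_C_C_mul (A := A) g
  have hinj := IsFractionRing.injective A L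
  have hG' : ∀ x y : A, algebraMap A L (G.evalEval x y)
      = algebraMap A L s * f.evalEval (algebraMap A L x + a) (algebraMap A L y + b) := by
    intro x y
    rw [← map_mapRingHom_evalEval, hG, evalEval_mul, hg, hev]
    simp
  have hGd : algebraMap A L (G.derivative.evalEval 0 0)
      = algebraMap A L s * f.derivative.evalEval a b := by
    rw [← map_mapRingHom_evalEval, ← derivative_map, hG, derivative_C_mul, evalEval_mul, hg,
      derivative_comp, derivative_map]
    simp [hev]
  have h0 : G.evalEval 0 0 = 0 := hinj (by simp [hG', hab])
  have hc : G.derivative.evalEval 0 0 ≠ 0 := by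
    intro h
    rw [h, map_zero, eq_comm, mul_eq_zero] at hGd
    exact hGd.elim (fun h => hs (hinj (by simpa using h))) hab'
  set c := G.derivative.evalEval 0 0
  have hinf := (IsLocalRing.infinite_maximalIdeal hA).image
    (f := fun m => algebraMap A L (c ^ 2 * m) + a) (by
      intro m _ n _ hmn
      exact mul_left_cancel₀ (pow_ne_zero 2 hc) (hinj (add_right_cancel hmn)))
  refine hinf.mono ?_
  rintro _ ⟨m, hm, rfl⟩
  obtain ⟨y, hy⟩ := HenselianLocalRing.exists_evalEval_eq_zero G h0 m hm
  refine ⟨algebraMap A L y + b, ?_⟩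
  have := hG' (c ^ 2 * m) y
  rw [hy, map_zero, eq_comm, mul_eq_zero] at this
  exact this.resolve_left fun h => hs (hinj (by simpa using h))

theorem IsLargeField.of_valuationSubring {L : Type*} [Field L] (A : ValuationSubring L)
    (hA : A ≠ ⊤) [HenselianLocalRing A] : IsLargeField L := by
  refine IsLargeField.of_henselian (A := A) fun h => hA ?_
  refine eq_top_iff.2 fun x _ => ?_
  obtain hx | hx := A.mem_or_inv_mem x
  · exact hx
  · by_cases h0 : x = 0
    · exact h0 ▸ A.zero_mem
    obtain ⟨y, hy⟩ := h.mul_inv_cancel (a := ⟨x⁻¹, hx⟩)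
      (fun h' => inv_ne_zero h0 (congrArg Subtype.val h'))
    have : x⁻¹ * (y : L) = 1 := congrArg Subtype.val hy
    rw [inv_mul_eq_one₀ h0] at this
    exact this ▸ y.2

/-! ### Transfer of largeness along local equivalence -/

/-- The universal closure of a local formula without free set variables. -/
def LocalFormula.allElems : (n : ℕ) → LocalFormula n 0 0 → LocalFormula 0 0 0
  | 0, φ => φ
  | n + 1, φ => allElems n (.neg (.exElem (.neg φ)))

theorem LocalFormula.realize_allElems {K : Type*} [CommRing K] [TopologicalSpace K] {n : ℕ}
    (φ : LocalFormula n 0 0) :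
    (allElems n φ).Realize K Fin.elim0 Fin.elim0 Fin.elim0 ↔
      ∀ v : Fin n → K, φ.Realize K v Fin.elim0 Fin.elim0 := by
  induction n with
  | zero =>
    exact ⟨fun h v => by rwa [Subsingleton.elim v Fin.elim0], fun h => h _⟩
  | succ n ih =>
    rw [allElems, ih]
    simp only [Realize, not_exists, not_not]
    exact ⟨fun h v => by simpa using h (Fin.init v) (v (Fin.last n)), fun h v x => h _⟩

/-- The two variables of `Fin 2` are placed after the `n` given ones, so that they are the ones bound
by two innermost existential quantifiers. -/
def LocalFormula.appendTwo (n : ℕ) : Fin n ⊕ Fin 2 → Fin (n + 1 + 1) :=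
  Sum.elim (fun i => i.castSucc.castSucc) ![(Fin.last n).castSucc, Fin.last (n + 1)]

theorem LocalFormula.snoc_snoc_comp_appendTwo {M : Type*} {n : ℕ} (w : Fin n → M) (x y : M) :
    (Fin.snoc (Fin.snoc w x : Fin (n + 1) → M) y : Fin (n + 1 + 1) → M) ∘ appendTwo n
      = Sum.elim w ![x, y] := by
  ext i
  rcases i with i | i
  · simp [appendTwo]
  · fin_cases i <;> simp [appendTwo]

/-- The formula `P = 0 → P' ≠ 0 → ∃ x y, Q = 0 ∧ R ≠ 0`. -/
noncomputable def LocalFormula.impExists {n : ℕ} (P P' : MvPolynomial (Fin n) ℤ)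
    (Q R : MvPolynomial (Fin n ⊕ Fin 2) ℤ) : LocalFormula n 0 0 :=
  .neg (.and (.eqZero P) (.and (.neg (.eqZero P')) (.neg (.exElem (.exElem
    (.and (.eqZero (MvPolynomial.rename (appendTwo n) Q))
      (.neg (.eqZero (MvPolynomial.rename (appendTwo n) R)))))))))

theorem LocalFormula.realize_impExists {M : Type*} [CommRing M] [TopologicalSpace M] {n : ℕ}
    (P P' : MvPolynomial (Fin n) ℤ) (Q R : MvPolynomial (Fin n ⊕ Fin 2) ℤ) (w : Fin n → M) :
    (impExists P P' Q R).Realize M w Fin.elim0 Fin.elim0 ↔ (MvPolynomial.aeval w P = 0 →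
      MvPolynomial.aeval w P' ≠ 0 → ∃ x y, MvPolynomial.aeval (Sum.elim w ![x, y]) Q = 0 ∧
        MvPolynomial.aeval (Sum.elim w ![x, y]) R ≠ 0) := by
  simp only [impExists, LocalFormula.Realize, MvPolynomial.aeval_rename,
    snoc_snoc_comp_appendTwo, not_and, not_not, ne_eq]

/-- Transfer of `∀ v, P(v) = 0 → P'(v) ≠ 0 → ∃ x y, Q(v, x, y) = 0 ∧ R(v, x, y) ≠ 0` along a local
equivalence; such a statement is a ring sentence, hence a local sentence without set variables. -/
theorem LocallyEquivalent.imp_exists {K L : Type*} [CommRing K] [TopologicalSpace K]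
    [CommRing L] [TopologicalSpace L] (h : LocallyEquivalent K L) {σ : Type*} [Finite σ]
    (P P' : MvPolynomial σ ℤ) (Q R : MvPolynomial (σ ⊕ Fin 2) ℤ)
    (hL : ∀ v : σ → L, MvPolynomial.aeval v P = 0 → MvPolynomial.aeval v P' ≠ 0 →
      ∃ x y, MvPolynomial.aeval (Sum.elim v ![x, y]) Q = 0 ∧
        MvPolynomial.aeval (Sum.elim v ![x, y]) R ≠ 0)
    (v : σ → K) (h0 : MvPolynomial.aeval v P = 0) (h1 : MvPolynomial.aeval v P' ≠ 0) :
    ∃ x y, MvPolynomial.aeval (Sum.elim v ![x, y]) Q = 0 ∧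
      MvPolynomial.aeval (Sum.elim v ![x, y]) R ≠ 0 := by
  obtain ⟨n, ⟨e⟩⟩ := Finite.exists_equiv_fin σ
  have key := h (LocalFormula.allElems n (LocalFormula.impExists (MvPolynomial.rename e P)
    (MvPolynomial.rename e P') (MvPolynomial.rename (Sum.map e id) Q)
    (MvPolynomial.rename (Sum.map e id) R)))
  simp only [LocalFormula.realize_allElems, LocalFormula.realize_impExists,
    MvPolynomial.aeval_rename, Sum.elim_comp_map, Function.comp_id] at key
  have := key.2 (fun w => hL (w ∘ e)) (v ∘ e.symm)
  simp only [Function.comp_assoc, Equiv.symm_comp_self, Function.comp_id] at this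
  exact this h0 h1

/-- The bivariate polynomial obtained by substituting `v` in the coefficients of `F`. -/
noncomputable def Polynomial.specialize {σ M : Type*} [CommRing M] (v : σ → M)
    (F : (MvPolynomial σ ℤ)[X][X]) : M[X][X] :=
  F.map (mapRingHom (MvPolynomial.aeval v : _ →ₐ[ℤ] M).toRingHom)

section Specialize

variable {σ τ M : Type*} [CommRing M] (w : σ → M)

theorem Polynomial.derivative_specialize (G : (MvPolynomial σ ℤ)[X][X]) :
    (Polynomial.specialize w G).derivative = Polynomial.specialize w G.derivative :=
  derivative_map ..

theorem Polynomial.aeval_evalEval (G : (MvPolynomial σ ℤ)[X][X]) (s t : MvPolynomial σ ℤ) :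
    MvPolynomial.aeval w (G.evalEval s t) =
      (Polynomial.specialize w G).evalEval (MvPolynomial.aeval w s) (MvPolynomial.aeval w t) :=
  (map_mapRingHom_evalEval (MvPolynomial.aeval w : _ →ₐ[ℤ] M).toRingHom G s t).symm

theorem Polynomial.specialize_specialize_X (w : τ → M) (g : σ → τ)
    (G : (MvPolynomial σ ℤ)[X][X]) :
    Polynomial.specialize w (Polynomial.specialize (fun i => MvPolynomial.X (g i)) G) =
      Polynomial.specialize (fun i => w (g i)) G := by
  rw [Polynomial.specialize, Polynomial.specialize, Polynomial.map_map, mapRingHom_comp]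
  unfold Polynomial.specialize
  congr 2
  exact congrArg AlgHom.toRingHom (MvPolynomial.algHom_ext (R := ℤ)
    (f := (MvPolynomial.aeval w).comp (MvPolynomial.aeval fun i => MvPolynomial.X (g i)))
    (g := MvPolynomial.aeval fun i => w (g i)) fun i => by simp)

/-- Every bivariate polynomial is a specialisation of a generic one of bounded degrees. -/
theorem Polynomial.exists_specialize_eq (f : M[X][X]) :
    ∃ (n : ℕ) (v : Fin n × Fin n → M) (F : (MvPolynomial (Fin n × Fin n) ℤ)[X][X]),
      Polynomial.specialize v F = f := by
  obtain ⟨n, hn, hn'⟩ :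
      ∃ n, f.natDegree < n ∧ ∀ i ∈ Finset.range n, (f.coeff i).natDegree < n := by
    refine ⟨max (f.natDegree + 1)
      ((Finset.range (f.natDegree + 1)).sup fun i => (f.coeff i).natDegree + 1), by simp, ?_⟩
    intro i _
    by_cases h : i < f.natDegree + 1
    · exact lt_max_of_lt_right ((Nat.lt_succ_self _).trans_le
        (Finset.le_sup (f := fun i => (f.coeff i).natDegree + 1) (Finset.mem_range.2 h)))
    · rw [coeff_eq_zero_of_natDegree_lt (by omega)]
      simp
  refine ⟨n, fun ij => (f.coeff ij.1).coeff ij.2,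
    ∑ i : Fin n, C (∑ j : Fin n, C (MvPolynomial.X (i, j)) * X ^ (j : ℕ)) * X ^ (i : ℕ), ?_⟩
  simp only [Polynomial.specialize, Polynomial.map_sum, Polynomial.map_mul, map_C,
    coe_mapRingHom, Polynomial.map_pow, map_X, AlgHom.toRingHom_eq_coe, RingHom.coe_coe,
    MvPolynomial.aeval_X]
  conv_rhs => rw [f.as_sum_range_C_mul_X_pow' hn]
  rw [Fin.sum_univ_eq_sum_range
    (fun i => C (∑ j : Fin n, C ((f.coeff i).coeff j) * X ^ (j : ℕ)) * X ^ i) n]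
  refine Finset.sum_congr rfl fun i hi => ?_
  conv_rhs => rw [(f.coeff i).as_sum_range_C_mul_X_pow' (hn' i hi)]
  rw [Fin.sum_univ_eq_sum_range (fun j => C ((f.coeff i).coeff j) * X ^ j) n]

end Specialize

/-- Largeness is preserved by local equivalence. It is expressed by ring sentences: for each shape of
`f` and each `r`, a smooth point on the curve yields a point whose abscissa differs from `r` given
elements. -/
theorem IsLargeField.of_locallyEquivalent {K L : Type*} [Field K] [TopologicalSpace K]
    [Field L] [TopologicalSpace L] (h : LocallyEquivalent K L) (hL : IsLargeField L) :
    IsLargeField K := by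
  intro f a b hab hab' hfin
  obtain ⟨n, c, F, rfl⟩ := Polynomial.exists_specialize_eq f
  set E := {x : K | ∃ y, evalEval x y (Polynomial.specialize c F) = 0} with hE
  have : Finite E := hfin
  have := Fintype.ofFinite E
  -- the variables: coefficients of `f`, the point `(a, b)`, and the elements to be avoided
  let σ := ((Fin n × Fin n) ⊕ Fin 2) ⊕ E
  let F' : (MvPolynomial σ ℤ)[X][X] :=
    Polynomial.specialize (fun i => MvPolynomial.X (Sum.inl (Sum.inl i))) F
  let F'' : (MvPolynomial (σ ⊕ Fin 2) ℤ)[X][X] :=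
    Polynomial.specialize (fun i => MvPolynomial.X (Sum.inl i)) F'
  let p : Fin 2 → MvPolynomial σ ℤ := fun i => MvPolynomial.X (Sum.inl (Sum.inr i))
  let q : Fin 2 → MvPolynomial (σ ⊕ Fin 2) ℤ := fun i => MvPolynomial.X (Sum.inr i)
  obtain ⟨x, y, h1, h2⟩ := h.imp_exists (F'.evalEval (p 0) (p 1))
    (F'.derivative.evalEval (p 0) (p 1)) (F''.evalEval (q 0) (q 1))
    (∏ e : E, (q 0 - MvPolynomial.X (Sum.inl (Sum.inr e))))
    (fun v h0 h1 => by
      rw [Polynomial.aeval_evalEval] at h0 h1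
      rw [← Polynomial.derivative_specialize] at h1
      obtain ⟨x, ⟨y, hy⟩, hx⟩ := (hL _ _ _ h0 h1).exists_notMem_finite
        (Set.finite_range fun e : E => v (Sum.inr e))
      refine ⟨x, y, ?_, ?_⟩
      · simpa [Polynomial.aeval_evalEval, F'', q, Polynomial.specialize_specialize_X] using hy
      rw [map_prod]
      refine Finset.prod_ne_zero_iff.2 fun e _ he => hx ⟨e, ?_⟩
      simpa [q] using (sub_eq_zero.1 (by simpa [q] using he)).symm)
    (Sum.elim (Sum.elim c ![a, b]) (↑))
    (by simpa [Polynomial.aeval_evalEval, F', p, Polynomial.specialize_specialize_X] using hab)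
    (by simpa [Polynomial.aeval_evalEval, F', p, Polynomial.specialize_specialize_X,
      ← Polynomial.derivative_specialize] using hab')
  rw [map_prod] at h2
  refine Finset.prod_ne_zero_iff.1 h2 ⟨x, y, ?_⟩ (Finset.mem_univ _) (by simp [q])
  simpa [Polynomial.aeval_evalEval, F', F'', q, Polynomial.specialize_specialize_X] using h1

theorem IsHenselianTopology.isLargeField {K : Type*} [Field K] {τ : TopologicalSpace K}
    (h : IsHenselianTopology τ) : IsLargeField K := by
  obtain ⟨-, L, _, A, hA, _, hL⟩ := h
  exact @IsLargeField.of_locallyEquivalent K L _ τ _ A.valuationTopology hL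
    (IsLargeField.of_valuationSubring A hA)

/-! ### Specialisations of finitely generated extensions into large fields -/

/-- A homomorphism `φ` from an integrally closed domain `P ⊆ F` to a field extends to `P[S]`, for a
set `S` of fractions with numerators in `P[θ]` and denominator `s`, as soon as `φ s ≠ 0` and the
image under `φ` of the minimal polynomial of `θ` has a root. -/
theorem exists_adjoin_extension_of_root {P F K : Type*} [CommRing P] [IsDomain P]
    [IsIntegrallyClosed P] [Field F] [Field K] [Algebra P F] [FaithfulSMul P F] (φ : P →+* K)
    {θ : F} (hθ : IsIntegral P θ) {θ' : K} (h : (minpoly P θ).eval₂ φ θ' = 0)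
    {s : P} (hs : φ s ≠ 0) {S : Set F}
    (hS : ∀ x ∈ S, s • x ∈ Algebra.adjoin P {θ}) :
    ∃ h : Algebra.adjoin P S →+* K, ∀ p, h (algebraMap P _ p) = φ p := by
  let _ : Algebra P K := φ.toAlgebra
  set B := Algebra.adjoin P {θ} with hB
  let g : B →ₐ[P] K := (AdjoinRoot.liftAlgHom (minpoly P θ) (Algebra.ofId P K) θ' h).comp
    (minpoly.equivAdjoin hθ).symm.toAlgHom
  have hs0 : s ≠ 0 := fun h => hs (by rw [h, map_zero])
  have hgs : g (algebraMap P B s) = φ s := g.commutes s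
  have hsF : algebraMap P F s ≠ 0 := by
    simpa using hs0
  have h1 : ∀ y : Submonoid.powers (algebraMap P B s), IsUnit (B.val y) := by
    rintro ⟨_, n, rfl⟩
    refine IsUnit.mk0 _ ?_
    rw [map_pow]
    exact pow_ne_zero _ hsF
  have h2 : ∀ y : Submonoid.powers (algebraMap P B s), IsUnit (g y) := by
    rintro ⟨_, n, rfl⟩
    refine IsUnit.mk0 _ ?_
    rw [map_pow, hgs]
    exact pow_ne_zero _ hs
  let R := Localization.Away (algebraMap P B s)
  let j : R →ₐ[P] F := IsLocalization.liftAlgHom (M := Submonoid.powers (algebraMap P B s)) h1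
  let k : R →ₐ[P] K := IsLocalization.liftAlgHom (M := Submonoid.powers (algebraMap P B s)) h2
  have hj : Function.Injective j := by
    refine (IsLocalization.lift_injective_iff (M := Submonoid.powers (algebraMap P B s)) h1).2
      fun x y => ?_
    rw [(IsLocalization.injective R (M := Submonoid.powers (algebraMap P B s))
      (powers_le_nonZeroDivisors_of_noZeroDivisors ?_)).eq_iff]
    · exact (Subtype.val_injective.eq_iff).symm
    · intro h0
      exact hsF (congrArg B.val h0)
  have hSj : Algebra.adjoin P S ≤ j.range := by
    refine Algebra.adjoin_le fun x hx => ?_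
    refine ⟨IsLocalization.mk' R (⟨s • x, hS x hx⟩ : B)
      (⟨_, Submonoid.mem_powers _⟩ : Submonoid.powers (algebraMap P B s)), ?_⟩
    refine (IsLocalization.lift_mk'_spec (S := R) (M := Submonoid.powers (algebraMap P B s))
      (g := (B.val : B →+* F)) ..).2 ?_
    simp [Algebra.smul_def]
  let f : Algebra.adjoin P S →ₐ[P] K :=
    k.comp ((AlgEquiv.ofInjective j hj).symm.toAlgHom.comp (Subalgebra.inclusion hSj))
  exact ⟨f.toRingHom, f.commutes⟩

theorem exists_ne_zero_smul_mem_adjoin {P M F : Type*} [CommRing P] [IsDomain P] [Field M]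
    [Field F] [Algebra P M] [IsFractionRing P M] [Algebra P F] [Algebra M F] [IsScalarTower P M F]
    {θ x : F} (hx : x ∈ Algebra.adjoin M {θ}) :
    ∃ s : P, s ≠ 0 ∧ s • x ∈ Algebra.adjoin P {θ} := by
  induction hx using Algebra.adjoin_induction with
  | mem x hx => exact ⟨1, one_ne_zero, by simpa using Algebra.subset_adjoin hx⟩
  | algebraMap r =>
    obtain ⟨a, b, hb, rfl⟩ := IsFractionRing.div_surjective (A := P) r
    refine ⟨b, nonZeroDivisors.ne_zero hb, ?_⟩
    have : algebraMap P M b ≠ 0 := by simpa using nonZeroDivisors.ne_zero hb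
    have e : b • algebraMap M F (algebraMap P M a / algebraMap P M b) = algebraMap P F a := by
      rw [Algebra.smul_def, IsScalarTower.algebraMap_apply P M F b, ← map_mul,
        mul_div_cancel₀ _ this, ← IsScalarTower.algebraMap_apply]
    rw [e]
    exact Subalgebra.algebraMap_mem _ _
  | add x y _ _ hx hy =>
    obtain ⟨s, hs, hx⟩ := hx
    obtain ⟨t, ht, hy⟩ := hy
    refine ⟨s * t, mul_ne_zero hs ht, ?_⟩
    rw [smul_add, mul_comm, mul_smul, mul_comm, mul_smul]
    exact add_mem (Subalgebra.smul_mem _ hx t) (Subalgebra.smul_mem _ hy s)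
  | mul x y _ _ hx hy =>
    obtain ⟨s, hs, hx⟩ := hx
    obtain ⟨t, ht, hy⟩ := hy
    refine ⟨s * t, mul_ne_zero hs ht, ?_⟩
    rw [← smul_mul_smul_comm]
    exact mul_mem hx hy

theorem exists_ne_zero_forall_smul_mem_adjoin {P M F : Type*} [CommRing P] [IsDomain P] [Field M]
    [Field F] [Algebra P M] [IsFractionRing P M] [Algebra P F] [Algebra M F] [IsScalarTower P M F]
    {θ : F} {S : Set F} (hfin : S.Finite) (hS : ∀ x ∈ S, x ∈ Algebra.adjoin M {θ}) :
    ∃ s : P, s ≠ 0 ∧ ∀ x ∈ S, s • x ∈ Algebra.adjoin P {θ} := by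
  induction S, hfin using Set.Finite.induction_on with
  | empty => exact ⟨1, one_ne_zero, by simp⟩
  | insert _ _ ih =>
    obtain ⟨s, hs, h⟩ := ih fun x hx => hS x (Set.mem_insert_of_mem _ hx)
    obtain ⟨t, ht, h'⟩ := exists_ne_zero_smul_mem_adjoin (P := P) (hS _ (Set.mem_insert _ _))
    refine ⟨s * t, mul_ne_zero hs ht, ?_⟩
    rintro x (rfl | hx)
    · rw [mul_smul]
      exact Subalgebra.smul_mem _ h' s
    · rw [mul_comm, mul_smul]
      exact Subalgebra.smul_mem _ (h x hx) t

theorem exists_integral_primitive_element (P M F : Type*) [CommRing P] [IsDomain P] [Field M]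
    [Field F] [Algebra P M] [IsFractionRing P M] [Algebra P F] [Algebra M F] [IsScalarTower P M F]
    [FiniteDimensional M F] [Algebra.IsSeparable M F] :
    ∃ θ : F, IsIntegral P θ ∧ Algebra.adjoin M {θ} = ⊤ := by
  obtain ⟨α, hα⟩ := Field.exists_primitive_element M F
  have halg : IsAlgebraic P α := by
    have : Algebra.IsAlgebraic P M := IsLocalization.isAlgebraic _ (nonZeroDivisors P)
    have : Algebra.IsAlgebraic P F := Algebra.IsAlgebraic.trans P M F
    exact Algebra.IsAlgebraic.isAlgebraic α
  obtain ⟨s, hs, hint⟩ := halg.exists_integral_multiple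
  refine ⟨s • α, hint, ?_⟩
  rw [← IntermediateField.adjoin_simple_toSubalgebra_of_isAlgebraic
      (IsAlgebraic.of_finite M (s • α)),
    ← IntermediateField.top_toSubalgebra (F := M) (E := F), ← hα]
  congr 1
  refine le_antisymm (hα ▸ le_top) (IntermediateField.adjoin_simple_le_iff.2 ?_)
  have hs' : algebraMap P M s ≠ 0 := by simpa using hs
  have h := (IntermediateField.adjoin M {s • α}).smul_mem (x := (algebraMap P M s)⁻¹)
    (IntermediateField.mem_adjoin_simple_self M (s • α))
  have e : (algebraMap P M s)⁻¹ • s • α = α := by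
    rw [← algebraMap_smul M s α, inv_smul_smul₀ hs']
  rwa [e] at h

/-- The evaluation homomorphism on `D[t]`, for algebraically independent `t`, that sends `t` to
`w`. -/
noncomputable def AlgebraicIndependent.eval {D F K ι : Type*} [CommRing D] [CommRing F]
    [CommRing K] [Algebra D F] [Algebra D K] {t : ι → F} (ht : AlgebraicIndependent D t)
    (w : ι → K) : Algebra.adjoin D (Set.range t) →ₐ[D] K :=
  (MvPolynomial.aeval w).comp ht.aevalEquiv.symm.toAlgHom

theorem AlgebraicIndependent.comp_eval {D F K K' ι : Type*} [CommRing D] [CommRing F]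
    [CommRing K] [CommRing K'] [Algebra D F] [Algebra D K] [Algebra D K'] {t : ι → F}
    (ht : AlgebraicIndependent D t) (w : ι → K) (f : K →ₐ[D] K')
    (p : Algebra.adjoin D (Set.range t)) : f (ht.eval w p) = ht.eval (fun i => f (w i)) p := by
  have := MvPolynomial.comp_aeval w f
  exact DFunLike.congr_fun this _

theorem AlgebraicIndependent.eval_self {D F ι : Type*} [CommRing D] [CommRing F]
    [Algebra D F] {t : ι → F} (ht : AlgebraicIndependent D t)
    (p : Algebra.adjoin D (Set.range t)) : ht.eval t p = p := by
  conv_rhs => rw [← ht.aevalEquiv.apply_symm_apply p]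
  exact (ht.algebraMap_aevalEquiv _).symm

open IntermediateField.algebraAdjoinAdjoin in
/-- The specialisation argument. Let `t` be a separating transcendence basis of the finitely
generated extension `F / D`, with `F = D(t)(θ)`. By largeness of `K`, specialisations of `t` on every
line through `t` extend to `θ`, and hence to the ring generated by `S`, for infinitely many points of
the line. If `x` always specialised into the finite set `A`, then a polynomial relation `G(t, x) = 0`
would give `G(u, a) = 0` for all `u` and some fixed `a ∈ A`, so that `a` would be algebraic over
`D`. -/
theorem IsLargeField.exists_subalgebra_algHom {D F K ι : Type*} [Field D] [Field F] [Field K]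
    [Algebra D F] [Algebra F K] [Algebra D K] [IsScalarTower D F K] (hK : IsLargeField K)
    [Algebra.EssFiniteType D F] {t : ι → F} (ht : IsTranscendenceBasis D t)
    [Algebra.IsSeparable (IntermediateField.adjoin D (Set.range t)) F]
    {S : Set F} (hS : S.Finite) {x : F} (hxS : x ∈ S) {A : Set K}
    (hA : A.Finite) (hA' : ∀ a ∈ A, Transcendental D a) :
    ∃ (R : Subalgebra D F) (hSR : S ⊆ R) (h : R →ₐ[D] K), h ⟨x, hSR hxS⟩ ∉ A := by
  by_contra! hcon
  let P := Algebra.adjoin D (Set.range t)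
  let M := IntermediateField.adjoin D (Set.range t)
  have : UniqueFactorizationMonoid P :=
    ht.1.aevalEquiv.toMulEquiv.uniqueFactorizationMonoid inferInstance
  have : Algebra.IsAlgebraic P F := ht.isAlgebraic
  have : Algebra.EssFiniteType M F := Algebra.EssFiniteType.of_comp D M F
  have : FiniteDimensional M F := Algebra.finite_of_essFiniteType_of_isAlgebraic
  obtain ⟨θ, hθ, hMθ⟩ := exists_integral_primitive_element P M F
  obtain ⟨s, hs, hsS⟩ := exists_ne_zero_forall_smul_mem_adjoin (P := P) (M := M) (θ := θ) hS
    (fun x _ => hMθ ▸ Algebra.mem_top)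
  obtain ⟨G, hG0, hG⟩ := Algebra.IsAlgebraic.isAlgebraic (R := P) x
  -- a specialisation `w` of `t` that extends to `θ` gives a root of `G` in `A`
  have hroot : ∀ w : ι → K, (∃ θ' : K, (minpoly P θ).eval₂ (ht.1.eval w).toRingHom θ' = 0) →
      ht.1.eval w s ≠ 0 → ∃ a ∈ A, G.eval₂ (ht.1.eval w).toRingHom a = 0 := by
    rintro w ⟨θ', hθ'⟩ hws
    obtain ⟨h, hP⟩ := exists_adjoin_extension_of_root (ht.1.eval w).toRingHom hθ hθ' (s := s)
      hws hsS
    let R : Subalgebra D F := (Algebra.adjoin P S).restrictScalars D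
    have hSR : S ⊆ R := Algebra.subset_adjoin
    let h' : R →ₐ[D] K :=
      { h with
        commutes' := fun r => (hP (algebraMap D P r)).trans ((ht.1.eval w).commutes r) }
    refine ⟨_, hcon R hSR h', ?_⟩
    have h1 : G.eval₂ (algebraMap P (Algebra.adjoin P S)) ⟨x, hSR hxS⟩ = 0 :=
      Subtype.val_injective ((aeval_algHom_apply (Algebra.adjoin P S).val _ G).symm.trans hG)
    have h2 := hom_eval₂ G (algebraMap P (Algebra.adjoin P S)) h ⟨x, hSR hxS⟩
    rw [h1, map_zero, show h.comp (algebraMap P _) = (ht.1.eval w).toRingHom from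
      RingHom.ext hP] at h2
    exact h2.symm
  -- by largeness there are infinitely many such `w` on each line through `t`, so that some `a ∈ A`
  -- is a root of `G` along the whole line
  have hline : ∀ u : ι → K, ∃ a ∈ A, G.eval₂ (ht.1.eval u).toRingHom a = 0 := by
    intro u
    -- the line through `t` and `u`, at `t` for `τ = 0` and at `u` for `τ = 1`
    let l : ι → K[X] := fun i => C (algebraMap F K (t i)) + X * C (u i - algebraMap F K (t i))
    let w : K → ι → K := fun τ i => (l i).eval τ
    have hl : ∀ (τ y : K) (g : P[X]),
        (g.eval₂ (ht.1.eval l).toRingHom (C y)).eval τ = g.eval₂ (ht.1.eval (w τ)).toRingHom y := by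
      intro τ y g
      rw [← coe_evalRingHom, hom_eval₂, coe_evalRingHom, eval_C]
      congr 1
      ext p
      exact ht.1.comp_eval l ((Polynomial.aeval (R := K) τ).restrictScalars D) p
    have hw0 : (ht.1.eval (w 0)).toRingHom = (algebraMap F K).comp (algebraMap P F) := by
      ext p
      have := ht.1.comp_eval t (IsScalarTower.toAlgHom D F K) p
      rw [ht.1.eval_self] at this
      simpa [w, l] using this.symm
    have hw1 : w 1 = u := by
      ext i
      simp [w, l]
    have hf : ∀ (g : P[X]) (τ y : K), (g.map (ht.1.eval l).toRingHom).evalEval τ y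
        = g.eval₂ (ht.1.eval (w τ)).toRingHom y := by
      intro g τ y
      rw [evalEval, eval_map, hl]
    have h0 : ∀ g : P[X], (g.map (ht.1.eval l).toRingHom).evalEval 0 (algebraMap F K θ)
        = algebraMap F K (aeval θ g) := by
      intro g
      rw [hf, hw0, ← hom_eval₂, aeval_def]
    have hsep : aeval θ (minpoly P θ).derivative ≠ 0 := by
      have hs := (Algebra.IsSeparable.isSeparable M θ).aeval_derivative_ne_zero
        (minpoly.aeval M θ)
      rwa [minpoly.isIntegrallyClosed_eq_field_fractions' M hθ, derivative_map,
        aeval_map_algebraMap] at hs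
    have hinf := hK ((minpoly P θ).map (ht.1.eval l).toRingHom) 0 (algebraMap F K θ)
      (by rw [h0, minpoly.aeval, map_zero])
      (by rw [derivative_map, h0]; simpa using hsep)
    have hls : ht.1.eval l s ≠ 0 := by
      intro h
      have h1 := hl 0 0 (C s)
      rw [eval₂_C, eval₂_C, hw0] at h1
      have h2 : (ht.1.eval l).toRingHom s = 0 := h
      rw [h2, eval_zero] at h1
      exact hs (by simpa using h1.symm)
    have hinf' := hinf.sdiff (Polynomial.finite_setOfPred_isRoot hls)
    obtain ⟨a, haA, ha⟩ : ∃ a ∈ A, {τ | G.eval₂ (ht.1.eval (w τ)).toRingHom a = 0}.Infinite := by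
      by_contra! hall
      refine hinf' ((hA.biUnion hall).subset ?_)
      rintro τ ⟨⟨y, hy⟩, hτ⟩
      have hτ' : ht.1.eval (w τ) s ≠ 0 := by
        intro h
        refine hτ ?_
        have h1 := hl τ 0 (C s)
        rw [eval₂_C, eval₂_C] at h1
        exact h1.trans h
      obtain ⟨a, ha, h⟩ := hroot (w τ) ⟨y, by rwa [← hf]⟩ hτ'
      exact Set.mem_biUnion ha h
    refine ⟨a, haA, ?_⟩
    have hz : G.eval₂ (ht.1.eval l).toRingHom (C a) = 0 :=
      eq_zero_of_infinite_isRoot _ (ha.mono fun τ hτ => (hl τ a G).trans hτ)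
    rw [← hw1, ← hl, hz, eval_zero]
  -- the product of the polynomials `G(T, a)` over `a ∈ A` vanishes everywhere, so one of them is
  -- zero
  have := hK.infinite
  obtain ⟨a, haA, ha⟩ : ∃ a ∈ A, G.eval₂
      (ht.1.eval (MvPolynomial.X : ι → MvPolynomial ι K)).toRingHom (MvPolynomial.C a) = 0 := by
    rw [← hA.coe_toFinset]
    refine Finset.prod_eq_zero_iff.1 (MvPolynomial.funext fun u => ?_)
    obtain ⟨a, haA, ha⟩ := hline u
    rw [map_prod, map_zero]
    refine Finset.prod_eq_zero (hA.mem_toFinset.2 haA) ?_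
    rw [hom_eval₂, MvPolynomial.eval_C, ← ha]
    congr 1
    ext p
    have := ht.1.comp_eval (MvPolynomial.X : ι → MvPolynomial ι K)
      ((MvPolynomial.aeval (R := K) u).restrictScalars D) p
    simpa using this
  refine hA' a haA ?_
  -- a nonzero coefficient of `G` with respect to the transcendence basis
  obtain ⟨k, hk⟩ : ∃ k, G.coeff k ≠ 0 := by
    by_contra! h
    exact hG0 (Polynomial.ext h)
  have hk' : ht.1.aevalEquiv.symm (G.coeff k) ≠ 0 := by simpa using hk
  obtain ⟨m, hm⟩ := MvPolynomial.ne_zero_iff.1 hk'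
  have hev : ∀ p : P, ht.1.eval (MvPolynomial.X : ι → MvPolynomial ι K) p
      = MvPolynomial.map (algebraMap D K) (ht.1.aevalEquiv.symm p) := fun p => by
    refine DFunLike.congr_fun (F := MvPolynomial ι D →ₐ[D] MvPolynomial ι K)
      (f := MvPolynomial.aeval MvPolynomial.X) (g := MvPolynomial.mapAlgHom (Algebra.ofId D K))
      (MvPolynomial.algHom_ext fun i => ?_) (ht.1.aevalEquiv.symm p)
    simp
  refine ⟨∑ i ∈ Finset.range (G.natDegree + 1),
    C (MvPolynomial.coeff m (ht.1.aevalEquiv.symm (G.coeff i))) * X ^ i, ?_, ?_⟩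
  · intro h
    have := congrArg (fun p => p.coeff k) h
    simp only [finsetSum_coeff, coeff_C_mul_X_pow, coeff_zero] at this
    rw [Finset.sum_ite_eq, if_pos] at this
    · exact hm this
    · exact Finset.mem_range.2 (Nat.lt_succ_of_le (le_natDegree_of_ne_zero hk))
  · have h1 := congrArg (MvPolynomial.coeff m) ha
    rw [eval₂_eq_sum_range, MvPolynomial.coeff_sum, MvPolynomial.coeff_zero] at h1
    rw [map_sum, ← h1]
    refine Finset.sum_congr rfl fun i _ => ?_
    rw [← map_pow, mul_comm _ (MvPolynomial.C _), MvPolynomial.coeff_C_mul]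
    have : (ht.1.eval (MvPolynomial.X : ι → MvPolynomial ι K)).toRingHom (G.coeff i) = _ :=
      hev (G.coeff i)
    rw [this, MvPolynomial.coeff_map]
    rw [map_mul, map_pow, aeval_C, aeval_X, mul_comm]

end

/-- A relation `∑ i, g i * v i ^ p = 0` over `D` is the `p`-th power of a relation between the `v i`
with coefficients in `D ^ (1 / p)`, over which the `v i` stay independent. -/
theorem Subfield.IsSeparableIn.linearIndependent_pow {K : Type*} [Field K] {D : Subfield K}
    (hD : D.IsSeparableIn) {ι : Type*} {v : ι → K} (hv : LinearIndependent D v) :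
    LinearIndependent D (fun i => v i ^ ringExpChar K) := by
  have hE : ExpChar (AlgebraicClosure K) (ringExpChar K) :=
    expChar_of_injective_algebraMap (algebraMap K (AlgebraicClosure K)).injective _
  have h := IntermediateField.LinearDisjoint.linearIndependent_right' hD hv
  rw [linearIndependent_iff'] at h ⊢
  intro s g hg i hi
  have hroot : ∀ i, ∃ r : D.pthRoots, (r : AlgebraicClosure K) ^ ringExpChar K
      = algebraMap K (AlgebraicClosure K) (g i) := fun i => by
    obtain ⟨r, hr⟩ := IsAlgClosed.exists_pow_nat_eq (algebraMap K (AlgebraicClosure K) (g i))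
      (expChar_pos K (ringExpChar K))
    exact ⟨⟨r, g i, hr⟩, hr⟩
  choose r hr using hroot
  have h0 := h s r (by
    refine eq_zero_of_pow_eq_zero (n := ringExpChar K) ?_
    rw [sum_pow_char, ← map_zero (algebraMap K (AlgebraicClosure K)), ← hg, map_sum]
    refine Finset.sum_congr rfl fun i _ => ?_
    rw [Algebra.smul_def, Algebra.smul_def, mul_pow, map_mul, map_pow]
    exact congrArg (· * _) (hr i)) i hi
  have h1 := hr i
  rw [h0] at h1
  have h2 : algebraMap K (AlgebraicClosure K) (g i) = 0 := by
    rw [← h1]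
    exact zero_pow (expChar_pos K (ringExpChar K)).ne'
  simpa using h2

/-- MacLane's criterion: a finitely generated subextension of a separable extension has a separating
transcendence basis. -/
theorem Subfield.IsSeparableIn.exists_isTranscendenceBasis {K : Type*} [Field K] {D : Subfield K}
    (hD : D.IsSeparableIn) (F : IntermediateField D K) [Algebra.EssFiniteType D F] :
    ∃ s : Finset F, IsTranscendenceBasis D ((↑) : s → F) ∧
      Algebra.IsSeparable (IntermediateField.adjoin D (s : Set F)) F := by
  obtain h1 | hp := (expChar_is_prime_or_one K (ringExpChar K)).symm
  · have : CharZero K := by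
      have := ringExpChar.expChar K
      rw [h1] at this
      exact charZero_of_expChar_one' K
    have : CharZero D := ((algebraMap D K).charZero_iff (algebraMap D K).injective).2 this
    exact exists_isTranscendenceBasis_and_isSeparable_of_perfectField D F
  · have : ExpChar D (ringExpChar K) :=
      (algebraMap D K).expChar (algebraMap D K).injective _
    refine exists_isTranscendenceBasis_and_isSeparable_of_linearIndepOn_pow_of_essFiniteType
      (ringExpChar K) hp fun s hs => ?_
    have h := hD.linearIndependent_pow (hs.map' F.val.toLinearMap
      (LinearMap.ker_eq_bot.2 F.val.injective))
    exact LinearIndependent.of_comp F.val.toLinearMap h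

/-- Over a subfield `D` with `K / D` separable, an element `x` of a finite set `S` can be moved out
of any finite set of transcendental elements by a specialisation, that is, a `D`-homomorphism to `K`
from a ring containing `S`. -/
theorem IsLargeField.exists_subalgebra_algHom_of_isSeparableIn {K : Type*} [Field K]
    (hK : IsLargeField K) {D : Subfield K} (hD : D.IsSeparableIn) {S : Set K} (hS : S.Finite)
    {x : K} (hx : x ∈ S) {A : Set K} (hA : A.Finite) (hA' : ∀ a ∈ A, Transcendental D a) :
    ∃ (R : Subalgebra D K) (hSR : S ⊆ R) (h : R →ₐ[D] K), h ⟨x, hSR hx⟩ ∉ A := by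
  let F := IntermediateField.adjoin D S
  have hSF : S ⊆ F := IntermediateField.subset_adjoin D S
  have : Algebra.EssFiniteType D F :=
    IntermediateField.essFiniteType_iff.2 (IntermediateField.fg_adjoin_of_finite hS)
  obtain ⟨s, hs, hsep⟩ := hD.exists_isTranscendenceBasis F
  have hr : Set.range ((↑) : s → F) = s := Subtype.range_coe
  rw [← hr] at hsep
  obtain ⟨R, hSR, h, hh⟩ := hK.exists_subalgebra_algHom hs
    (hS.preimage (f := F.val) F.val.injective.injOn) (x := ⟨x, hSF hx⟩) hx hA hA'
  let e := R.equivMapOfInjective F.val F.val.injective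
  refine ⟨R.map F.val, fun y hy => ⟨⟨y, hSF hy⟩, hSR hy, rfl⟩, h.comp e.symm.toAlgHom, ?_⟩
  have : e.symm ⟨x, ⟨⟨x, hSF hx⟩, hSR hx, rfl⟩⟩ = ⟨⟨x, hSF hx⟩, hSR hx⟩ := by
    rw [AlgEquiv.symm_apply_eq]
    rfl
  change h (e.symm _) ∉ A
  rwa [this]

section

open MvPolynomial

/-! ### Diophantine sets -/

/-- A set of `V`-tuples of elements of the field `K` is diophantine over `B` if it is a projection of
the solution set of a finite system of polynomial equations with coefficients in the ring generated
by `B`. The polynomials have integer coefficients and one variable for each coordinate in `V`, each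
auxiliary unknown in `τ`, and each parameter in `B`. -/
def IsDiophantine {K : Type*} [Field K] (B : Set K) {V : Type} (W : Set (V → K)) : Prop :=
  ∃ (τ ι : Type) (_ : Finite τ) (_ : Finite ι) (p : ι → MvPolynomial ((V ⊕ τ) ⊕ B) ℤ),
    ∀ v, v ∈ W ↔ ∃ y : τ → K, ∀ i, aeval (Sum.elim (Sum.elim v y) ((↑) : B → K)) (p i) = 0

namespace IsDiophantine

variable {K : Type*} [Field K] {B : Set K} {V V' : Type} {W W' : Set (V → K)}

theorem setOf_aeval_eq_zero (p : MvPolynomial (V ⊕ B) ℤ) :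
    IsDiophantine B {v : V → K | aeval (Sum.elim v ((↑) : B → K)) p = 0} := by
  refine ⟨Empty, Unit, inferInstance, inferInstance, fun _ => rename (Sum.map Sum.inl id) p,
    fun v => ?_⟩
  simp [aeval_rename, Sum.elim_comp_map]

theorem inter (h : IsDiophantine B W) (h' : IsDiophantine B W') : IsDiophantine B (W ∩ W') := by
  obtain ⟨τ, ι, _, _, p, hp⟩ := h
  obtain ⟨τ', ι', _, _, p', hp'⟩ := h'
  refine ⟨τ ⊕ τ', ι ⊕ ι', inferInstance, inferInstance,
    Sum.elim (fun i => rename (Sum.map (Sum.map id Sum.inl) id) (p i))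
      (fun i => rename (Sum.map (Sum.map id Sum.inr) id) (p' i)), fun v => ?_⟩
  rw [Set.mem_inter_iff, hp, hp']
  simp only [Sum.forall, Sum.elim_inl, Sum.elim_inr, aeval_rename, Sum.elim_comp_map,
    Function.comp_id]
  constructor
  · rintro ⟨⟨y, hy⟩, y', hy'⟩
    exact ⟨Sum.elim y y', by simpa using hy, by simpa using hy'⟩
  · rintro ⟨y, hy, hy'⟩
    exact ⟨⟨_, hy⟩, _, hy'⟩

theorem union (h : IsDiophantine B W) (h' : IsDiophantine B W') : IsDiophantine B (W ∪ W') := by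
  obtain ⟨τ, ι, _, _, p, hp⟩ := h
  obtain ⟨τ', ι', _, _, p', hp'⟩ := h'
  refine ⟨τ ⊕ τ', ι × ι', inferInstance, inferInstance,
    fun i => rename (Sum.map (Sum.map id Sum.inl) id) (p i.1) *
      rename (Sum.map (Sum.map id Sum.inr) id) (p' i.2), fun v => ?_⟩
  rw [Set.mem_union, hp, hp']
  simp only [aeval_rename, Sum.elim_comp_map, Function.comp_id, map_mul, mul_eq_zero, Prod.forall]
  constructor
  · rintro (⟨y, hy⟩ | ⟨y, hy⟩)
    · exact ⟨Sum.elim y 0, fun i j => Or.inl (by simpa using hy i)⟩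
    · exact ⟨Sum.elim 0 y, fun i j => Or.inr (by simpa using hy j)⟩
  · rintro ⟨y, hy⟩
    by_contra! h
    obtain ⟨i, hi⟩ := h.1 (y ∘ Sum.inl)
    obtain ⟨j, hj⟩ := h.2 (y ∘ Sum.inr)
    exact (hy i j).elim hi hj

theorem iInter {ι : Type*} [Finite ι] {W : ι → Set (V → K)} (h : ∀ i, IsDiophantine B (W i)) :
    IsDiophantine B (⋂ i, W i) := by
  induction ι using Finite.induction_empty_option with
  | of_equiv e ih => rw [← e.surjective.iInter_comp]; exact ih fun i => h (e i)
  | h_empty =>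
    rw [Set.iInter_of_empty]
    simpa using setOf_aeval_eq_zero (V := V) (0 : MvPolynomial (V ⊕ B) ℤ)
  | h_option ih =>
    rw [Set.iInter_option]
    exact (h _).inter (ih fun i => h _)

theorem preimage (h : IsDiophantine B W) (g : V → V') :
    IsDiophantine B {v : V' → K | v ∘ g ∈ W} := by
  obtain ⟨τ, ι, _, _, p, hp⟩ := h
  refine ⟨τ, ι, inferInstance, inferInstance,
    fun i => rename (Sum.map (Sum.map g id) id) (p i), fun v => ?_⟩
  simp only [Set.mem_ofPred_eq, hp, aeval_rename, Sum.elim_comp_map, Function.comp_id]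

theorem exists_right {τ : Type} [Finite τ] {W : Set (V ⊕ τ → K)} (h : IsDiophantine B W) :
    IsDiophantine B {v : V → K | ∃ y, Sum.elim v y ∈ W} := by
  obtain ⟨τ', ι, _, _, p, hp⟩ := h
  refine ⟨τ ⊕ τ', ι, inferInstance, inferInstance,
    fun i => rename (Sum.map (Equiv.sumAssoc V τ τ') id) (p i), fun v => ?_⟩
  have key : ∀ y z, Sum.elim v (Sum.elim y z) ∘ Equiv.sumAssoc V τ τ'
      = Sum.elim (Sum.elim v y) (z : τ' → K) := by
    intro y z
    ext i
    rcases i with (i | i) | i <;> rfl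
  simp only [Set.mem_ofPred_eq, hp, aeval_rename, Sum.elim_comp_map, Function.comp_id]
  constructor
  · rintro ⟨y, z, h⟩
    exact ⟨Sum.elim y z, by simpa only [key] using h⟩
  · rintro ⟨y, h⟩
    refine ⟨y ∘ Sum.inl, y ∘ Sum.inr, ?_⟩
    simpa only [← key, Sum.elim_comp_inl_inr] using h

theorem setOf_aeval_ne_zero (p : MvPolynomial (V ⊕ B) ℤ) :
    IsDiophantine B {v : V → K | aeval (Sum.elim v ((↑) : B → K)) p ≠ 0} := by
  have := (setOf_aeval_eq_zero (K := K) (rename (Sum.map (Sum.inl : V → V ⊕ Unit) id) p *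
    X (Sum.inl (Sum.inr ())) - 1)).exists_right
  convert this using 1
  ext v
  simp only [Set.mem_ofPred_eq, map_sub, map_mul, aeval_rename, aeval_X, map_one,
    Sum.elim_comp_map, Function.comp_id, sub_eq_zero, Sum.elim_inl, Sum.elim_inr]
  constructor
  · exact fun h => ⟨fun _ => _, mul_inv_cancel₀ h⟩
  · rintro ⟨y, hy⟩
    exact left_ne_zero_of_mul_eq_one hy

/-- Coordinates may be set equal to parameters whose singletons are diophantine. -/
theorem specialize {τ : Type} [Finite τ] {W : Set (V ⊕ τ → K)} (h : IsDiophantine B W)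
    {c : τ → K} (hc : ∀ i, IsDiophantine B {v : Fin 1 → K | v 0 = c i}) :
    IsDiophantine B {v : V → K | Sum.elim v c ∈ W} := by
  have := (h.inter (iInter fun i => (hc i).preimage fun _ => Sum.inr i)).exists_right
  convert this using 1
  ext v
  simp only [Set.mem_ofPred_eq, Set.mem_inter_iff, Set.mem_iInter, Function.comp_apply,
    Sum.elim_inr]
  constructor
  · exact fun h => ⟨c, h, fun _ => rfl⟩
  · rintro ⟨y, hy, hyc⟩
    rwa [← funext hyc]

end IsDiophantine

/-! ### Diophantine sets and existential formulas -/

open FirstOrder Language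

section

variable {K : Type*} [Field K] {B : Set K}

theorem FirstOrder.Ring.exists_aeval_eq_realize {V : Type}
    (t : (Language.ring.withConstants B).Term V) :
    letI := FirstOrder.Ring.compatibleRingOfRing K
    ∃ p : MvPolynomial (V ⊕ B) ℤ, ∀ v : V → K,
      t.realize v = aeval (Sum.elim v ((↑) : B → K)) p := by
  let _ := FirstOrder.Ring.compatibleRingOfRing K
  induction t with
  | var i => exact ⟨X (Sum.inl i), fun v => by simp⟩
  | func f ts ih =>
    choose p hp using ih
    rcases f with f | f
    · cases f with
      | add =>
        refine ⟨p 0 + p 1, fun v => ?_⟩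
        simp only [map_add, ← hp]
        rfl
      | mul =>
        refine ⟨p 0 * p 1, fun v => ?_⟩
        simp only [map_mul, ← hp]
        rfl
      | neg =>
        refine ⟨-p 0, fun v => ?_⟩
        simp only [map_neg, ← hp]
        rfl
      | zero =>
        refine ⟨0, fun v => ?_⟩
        simp only [map_zero]
        rfl
      | one =>
        refine ⟨1, fun v => ?_⟩
        simp only [map_one]
        rfl
    · rename_i n
      match n, f with
      | 0, b => exact ⟨X (Sum.inr b), fun v => by
          simp only [Term.realize, aeval_X]
          rfl⟩

theorem FirstOrder.Ring.exists_realize_eq_aeval {V : Type} (p : MvPolynomial (V ⊕ B) ℤ) :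
    letI := FirstOrder.Ring.compatibleRingOfRing K
    ∃ t : (Language.ring.withConstants B).Term V, ∀ v : V → K,
      t.realize v = aeval (Sum.elim v ((↑) : B → K)) p := by
  let _ := FirstOrder.Ring.compatibleRingOfRing K
  have hadd : ∀ s t : (Language.ring.withConstants B).Term V,
      ∃ r : (Language.ring.withConstants B).Term V, ∀ v : V → K,
        r.realize v = s.realize v + t.realize v :=
    fun s t => ⟨.func (Sum.inl Ring.addFunc) ![s, t], fun v => rfl⟩
  have hmul : ∀ s t : (Language.ring.withConstants B).Term V,
      ∃ r : (Language.ring.withConstants B).Term V, ∀ v : V → K,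
        r.realize v = s.realize v * t.realize v :=
    fun s t => ⟨.func (Sum.inl Ring.mulFunc) ![s, t], fun v => rfl⟩
  have hneg : ∀ t : (Language.ring.withConstants B).Term V,
      ∃ r : (Language.ring.withConstants B).Term V, ∀ v : V → K,
        r.realize v = - t.realize v :=
    fun t => ⟨.func (Sum.inl Ring.negFunc) ![t], fun v => rfl⟩
  have h0 : ∃ r : (Language.ring.withConstants B).Term V, ∀ v : V → K, r.realize v = 0 :=
    ⟨.func (Sum.inl Ring.zeroFunc) ![], fun v => rfl⟩
  have h1 : ∃ r : (Language.ring.withConstants B).Term V, ∀ v : V → K, r.realize v = 1 :=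
    ⟨.func (Sum.inl Ring.oneFunc) ![], fun v => rfl⟩
  induction p using MvPolynomial.induction_on with
  | C n =>
    induction n using Int.induction_on with
    | zero => simpa using h0
    | succ n ih =>
      obtain ⟨s, hs⟩ := ih
      obtain ⟨t, ht⟩ := h1
      obtain ⟨r, hr⟩ := hadd s t
      exact ⟨r, fun v => by simp [hr, hs, ht]⟩
    | pred n ih =>
      obtain ⟨s, hs⟩ := ih
      obtain ⟨t, ht⟩ := h1
      obtain ⟨t', ht'⟩ := hneg t
      obtain ⟨r, hr⟩ := hadd s t'
      exact ⟨r, fun v => by simp [hr, hs, ht', ht, sub_eq_add_neg]⟩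
  | add p q hp hq =>
    obtain ⟨s, hs⟩ := hp
    obtain ⟨t, ht⟩ := hq
    obtain ⟨r, hr⟩ := hadd s t
    exact ⟨r, fun v => by simp [hr, hs, ht]⟩
  | mul_X p i hp =>
    obtain ⟨s, hs⟩ := hp
    have hi : ∃ t : (Language.ring.withConstants B).Term V, ∀ v : V → K,
        t.realize v = Sum.elim v ((↑) : B → K) i := by
      rcases i with i | b
      · exact ⟨.var i, fun v => rfl⟩
      · exact ⟨.func (Sum.inr b : (Language.ring.withConstants B).Functions 0) ![], fun v => rfl⟩
    obtain ⟨t, ht⟩ := hi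
    obtain ⟨r, hr⟩ := hmul s t
    exact ⟨r, fun v => by simp [hr, hs, ht]⟩

/-- Over a field, the set defined by a quantifier-free formula is diophantine. The complement is part
of the statement so that negations can be handled by induction. -/
theorem FirstOrder.Language.BoundedFormula.IsQF.isDiophantine {V : Type} {n : ℕ}
    {φ : (Language.ring.withConstants B).BoundedFormula V n} (hφ : φ.IsQF) :
    letI := FirstOrder.Ring.compatibleRingOfRing K
    IsDiophantine B {w : V ⊕ Fin n → K | φ.Realize (w ∘ Sum.inl) (w ∘ Sum.inr)} ∧
      IsDiophantine B {w : V ⊕ Fin n → K | ¬ φ.Realize (w ∘ Sum.inl) (w ∘ Sum.inr)} := by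
  let _ := FirstOrder.Ring.compatibleRingOfRing K
  induction hφ with
  | falsum =>
    have h0 := IsDiophantine.setOf_aeval_ne_zero (K := K) (B := B) (V := V ⊕ Fin n) 0
    have h1 := IsDiophantine.setOf_aeval_eq_zero (K := K) (B := B) (V := V ⊕ Fin n) 0
    simp only [map_zero, ne_eq, not_true_eq_false] at h0 h1
    exact ⟨h0, by simpa [BoundedFormula.Realize] using h1⟩
  | of_isAtomic h =>
    cases h with
    | equal s t =>
      obtain ⟨p, hp⟩ := FirstOrder.Ring.exists_aeval_eq_realize s
      obtain ⟨q, hq⟩ := FirstOrder.Ring.exists_aeval_eq_realize t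
      have h0 := IsDiophantine.setOf_aeval_eq_zero (p - q)
      have h1 := IsDiophantine.setOf_aeval_ne_zero (p - q)
      simp only [map_sub, sub_eq_zero, ← hp, ← hq, ne_eq] at h0 h1
      simpa only [BoundedFormula.realize_bdEqual, Sum.elim_comp_inl_inr] using ⟨h0, h1⟩
    | rel R ts => rcases R with R | R <;> cases R
  | imp _ _ ih₁ ih₂ =>
    refine ⟨?_, ?_⟩
    · convert ih₁.2.union ih₂.1 using 1
      ext w
      simp [imp_iff_not_or]
    · convert ih₁.1.inter ih₂.2 using 1
      ext w
      simp

theorem FirstOrder.Language.BoundedFormula.IsExistential.isDiophantine {V : Type} {n : ℕ}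
    {φ : (Language.ring.withConstants B).BoundedFormula V n} (hφ : φ.IsExistential) :
    letI := FirstOrder.Ring.compatibleRingOfRing K
    IsDiophantine B {w : V ⊕ Fin n → K | φ.Realize (w ∘ Sum.inl) (w ∘ Sum.inr)} := by
  let _ := FirstOrder.Ring.compatibleRingOfRing K
  induction hφ with
  | of_isQF h => exact h.isDiophantine.1
  | @ex n φ _ ih =>
    let g : V ⊕ Fin (n + 1) → (V ⊕ Fin n) ⊕ Fin 1 :=
      Sum.elim (fun i => Sum.inl (Sum.inl i))
        (Fin.snoc (α := fun _ => (V ⊕ Fin n) ⊕ Fin 1) (fun i => Sum.inl (Sum.inr i)) (Sum.inr 0))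
    convert (ih.preimage g).exists_right using 1
    ext w
    have key : ∀ y : Fin 1 → K, (Sum.elim w y ∘ g) ∘ Sum.inr = Fin.snoc (w ∘ Sum.inr) (y 0) := by
      intro y
      ext i
      refine Fin.lastCases ?_ (fun i => ?_) i <;> simp [g]
    have key' : ∀ y : Fin 1 → K, (Sum.elim w y ∘ g) ∘ Sum.inl = w ∘ Sum.inl := fun y => rfl
    simp only [Set.mem_ofPred_eq, BoundedFormula.realize_ex, key, key']
    exact ⟨fun ⟨x, h⟩ => ⟨fun _ => x, h⟩, fun ⟨y, h⟩ => ⟨y 0, h⟩⟩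

theorem FirstOrder.Language.BoundedFormula.IsExistential.exs {L : Language} {V : Type*} {n : ℕ}
    {φ : L.BoundedFormula V n} (hφ : φ.IsExistential) :
    BoundedFormula.IsExistential φ.exs := by
  induction n with
  | zero => exact hφ
  | succ n ih => exact ih hφ.ex

theorem FirstOrder.Language.BoundedFormula.exists_isQF_forall {L : Language} {M : Type*}
    [L.Structure M] {V : Type*} {n : ℕ} {ι : Type*} [Finite ι]
    {φ : ι → L.BoundedFormula V n} (hφ : ∀ i, (φ i).IsQF) :
    ∃ ψ : L.BoundedFormula V n, ψ.IsQF ∧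
      ∀ (v : V → M) (xs : Fin n → M), ψ.Realize v xs ↔ ∀ i, (φ i).Realize v xs := by
  induction ι using Finite.induction_empty_option with
  | of_equiv e ih =>
    obtain ⟨ψ, hψ, h⟩ := ih fun i => hφ (e i)
    exact ⟨ψ, hψ, fun v xs =>
      (h v xs).trans (e.forall_congr_right (q := fun i => (φ i).Realize v xs))⟩
  | h_empty => exact ⟨⊤, .top, by simp⟩
  | h_option ih =>
    obtain ⟨ψ, hψ, h⟩ := ih fun i => hφ (some i)
    exact ⟨φ none ⊓ ψ, (hφ none).inf hψ, fun v xs => by simp [h, Option.forall]⟩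

theorem existentiallyDefinable_iff_isDiophantine {A : Set K} :
    ExistentiallyDefinable B A ↔ IsDiophantine B {v : Fin 1 → K | v 0 ∈ A} := by
  let _ := FirstOrder.Ring.compatibleRingOfRing K
  constructor
  · rintro ⟨φ, hφ, rfl⟩
    convert hφ.isDiophantine.preimage (Sum.elim id Fin.elim0) using 1
    ext v
    have h1 : (fun _ => v 0) = (v ∘ Sum.elim id Fin.elim0) ∘ (Sum.inl : _ → Fin 1 ⊕ Fin 0) := by
      ext i
      rw [Subsingleton.elim i 0]
      rfl
    simp only [Set.mem_ofPred_eq, Formula.Realize, h1]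
    rw [Subsingleton.elim default ((v ∘ Sum.elim id Fin.elim0) ∘ Sum.inr)]
  · rintro ⟨τ, ι, _, _, p, hp⟩
    obtain ⟨n, ⟨e⟩⟩ := Finite.exists_equiv_fin τ
    choose t ht using fun i => FirstOrder.Ring.exists_realize_eq_aeval
      (rename (Sum.map (Sum.map id e) id) (p i))
    obtain ⟨ψ, hψ, h⟩ := FirstOrder.Language.BoundedFormula.exists_isQF_forall (M := K)
      (φ := fun i => (t i).bdEqual (.func (Sum.inl Ring.zeroFunc) ![]))
      fun i => (BoundedFormula.IsAtomic.equal _ _).isQF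
    refine ⟨ψ.exs, hψ.isExistential.exs, ?_⟩
    ext x
    have h0 : ∀ v : Fin 1 ⊕ Fin n → K, Term.realize v
        (.func (Sum.inl Ring.zeroFunc) ![] : (Language.ring.withConstants B).Term _) = 0 :=
      fun v => rfl
    have hx := hp fun _ => x
    simp only [Set.mem_ofPred_eq] at hx
    simp only [hx, Set.mem_ofPred_eq, BoundedFormula.realize_exs, h, BoundedFormula.realize_bdEqual,
      ht, h0, aeval_rename, Sum.elim_comp_map, Function.comp_id]
    exact e.arrowCongr (Equiv.refl K) |>.exists_congr_left.trans (by simp [Equiv.arrowCongr])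

end

/-! ### The existential definable and algebraic closures -/

section

variable {K : Type*} [Field K] {B : Set K}

theorem mem_existentialDcl_iff {x : K} :
    x ∈ existentialDcl B ↔ IsDiophantine B {v : Fin 1 → K | v 0 = x} :=
  existentiallyDefinable_iff_isDiophantine

theorem existentialDcl_subset_existentialAcl : existentialDcl B ⊆ existentialAcl B :=
  fun x hx => ⟨{x}, ⟨Set.finite_singleton x, hx⟩, rfl⟩

theorem IsDiophantine.setOf_aeval_eq_zero_of_mem_existentialDcl {V τ : Type} [Finite τ]
    {c : τ → K} (hc : ∀ i, c i ∈ existentialDcl B) (p : MvPolynomial (V ⊕ τ) ℤ) :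
    IsDiophantine B {v : V → K | aeval (Sum.elim v c) p = 0} := by
  have := (IsDiophantine.setOf_aeval_eq_zero (K := K) (B := B) (rename Sum.inl p)).specialize
    fun i => mem_existentialDcl_iff.1 (hc i)
  simpa only [Set.mem_ofPred_eq, aeval_rename, Sum.elim_comp_inl] using this

/-- An element that is the only root of an integer polynomial with parameters in `dcl_∃(B)` lies in
`dcl_∃(B)`. -/
theorem mem_existentialDcl_of_aeval {τ : Type} [Finite τ] {c : τ → K}
    (hc : ∀ i, c i ∈ existentialDcl B) (p : MvPolynomial (Fin 1 ⊕ τ) ℤ) {x : K}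
    (hx : ∀ z, aeval (Sum.elim (fun _ => z) c) p = 0 ↔ z = x) : x ∈ existentialDcl B := by
  rw [mem_existentialDcl_iff]
  convert IsDiophantine.setOf_aeval_eq_zero_of_mem_existentialDcl hc p using 1
  ext v
  have : v = fun _ => v 0 := funext fun i => by rw [Subsingleton.elim i 0]
  rw [Set.mem_ofPred_eq, Set.mem_ofPred_eq, this, hx]

variable (B) in
/-- The existential definable closure of `B`, as a subfield. -/
def existentialDclSubfield : Subfield K where
  carrier := existentialDcl B
  mul_mem' {a b} ha hb := mem_existentialDcl_of_aeval (c := ![a, b])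
    (by simp [Fin.forall_fin_two, ha, hb]) (X (Sum.inl 0) - X (Sum.inr 0) * X (Sum.inr 1))
    (by simp [sub_eq_zero])
  one_mem' := mem_existentialDcl_of_aeval (c := ![]) (by simp) (X (Sum.inl 0) - 1)
    (by simp [sub_eq_zero])
  add_mem' {a b} ha hb := mem_existentialDcl_of_aeval (c := ![a, b])
    (by simp [Fin.forall_fin_two, ha, hb]) (X (Sum.inl 0) - (X (Sum.inr 0) + X (Sum.inr 1)))
    (by simp [sub_eq_zero])
  zero_mem' := mem_existentialDcl_of_aeval (c := ![]) (by simp) (X (Sum.inl 0)) (by simp)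
  neg_mem' {a} ha := mem_existentialDcl_of_aeval (c := ![a]) (by simp [ha])
    (X (Sum.inl 0) + X (Sum.inr 0)) (by simp [eq_neg_iff_add_eq_zero])
  inv_mem' a ha := by
    by_cases h0 : a = 0
    · rwa [h0, inv_zero, ← h0]
    · exact mem_existentialDcl_of_aeval (c := ![a]) (by simp [ha])
        (X (Sum.inl 0) * X (Sum.inr 0) - 1) (by simp [sub_eq_zero, mul_eq_one_iff_eq_inv₀ h0])

theorem mem_existentialDclSubfield {x : K} :
    x ∈ existentialDclSubfield B ↔ x ∈ existentialDcl B := Iff.rfl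

theorem subset_existentialDcl : B ⊆ existentialDcl B := by
  intro b hb
  rw [mem_existentialDcl_iff]
  have := IsDiophantine.setOf_aeval_eq_zero (K := K)
    (X (Sum.inl 0) - X (Sum.inr ⟨b, hb⟩) : MvPolynomial (Fin 1 ⊕ B) ℤ)
  simpa only [map_sub, aeval_X, Sum.elim_inl, Sum.elim_inr, sub_eq_zero] using this

/-- The coordinates of a tuple that is the only element of a diophantine set lie in `dcl_∃(B)`. -/
theorem mem_existentialDcl_of_forall_eq {n : ℕ} {W : Set (Fin n → K)} (hW : IsDiophantine B W)
    {k : Fin n → K} (hk : ∀ v, v ∈ W ↔ v = k) (i : Fin n) : k i ∈ existentialDcl B := by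
  rw [mem_existentialDcl_iff]
  have h1 := hW.preimage (Sum.inr : Fin n → Fin 1 ⊕ Fin n)
  have h2 := IsDiophantine.setOf_aeval_eq_zero (K := K)
    (X (Sum.inl (Sum.inl 0)) - X (Sum.inl (Sum.inr i)) : MvPolynomial ((Fin 1 ⊕ Fin n) ⊕ B) ℤ)
  convert (h1.inter h2).exists_right using 1
  ext v
  simp [hk, sub_eq_zero]

/-- `K` is separable over `dcl_∃(B)`. If an element `a` is a `K`-linear combination of
`K`-independent elements `x i`, where `a ^ p` and the `x i ^ p` lie in `dcl_∃(B)`, then the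
coefficients `k i` form the only solution of `a ^ p = ∑ i, k i ^ p * x i ^ p`, and are therefore
themselves in `dcl_∃(B)`. -/
theorem existentialDclSubfield_isSeparableIn : (existentialDclSubfield B).IsSeparableIn := by
  classical
  have hE : ExpChar (AlgebraicClosure K) (ringExpChar K) :=
    expChar_of_injective_algebraMap (algebraMap K (AlgebraicClosure K)).injective _
  set D := existentialDclSubfield B with hDdef
  rw [Subfield.isSeparableIn_iff]
  intro s
  induction s using Finset.induction_on with
  | empty => intro _ _; simp
  | insert a s has ih =>
    intro hs hD
    rw [Finset.coe_insert] at hD ⊢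
    have has' : a ∉ (s : Set (AlgebraicClosure K)) := by simpa using has
    rw [linearIndepOn_id_insert has'] at hD ⊢
    have hsK := ih (fun x hx => hs x (Finset.mem_insert_of_mem hx)) hD.1
    refine ⟨hsK, fun haK => hD.2 ?_⟩
    let x : Fin s.card → AlgebraicClosure K := fun i => (s.equivFin.symm i : AlgebraicClosure K)
    have hxs : ∀ i, x i ∈ s := fun i => (s.equivFin.symm i).2
    have hrange : Set.range x = s := by
      rw [show x = Subtype.val ∘ s.equivFin.symm from rfl, EquivLike.range_comp, Subtype.range_coe]
    have hx : LinearIndependent K x := by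
      have : LinearIndependent K (fun y : (s : Set (AlgebraicClosure K)) =>
        (y : AlgebraicClosure K)) := hsK
      exact this.comp _ s.equivFin.symm.injective
    rw [← hrange] at haK ⊢
    obtain ⟨k, hk⟩ := (Submodule.mem_span_range_iff_exists_fun K).1 haK
    obtain ⟨α, hα⟩ := hs a (Finset.mem_insert_self _ _)
    choose d hd using fun i => hs (x i) (Finset.mem_insert_of_mem (hxs i))
    -- `k` is the only solution of `α = ∑ i, k i ^ p * d i`
    have hiff : ∀ l : Fin s.card → K,
        ∑ i, l i ^ ringExpChar K * (d i : K) - α = 0 ↔ l = k := by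
      have hpow : ∀ l : Fin s.card → K, algebraMap K (AlgebraicClosure K)
          (∑ i, l i ^ ringExpChar K * (d i : K)) = (∑ i, l i • x i) ^ ringExpChar K := by
        intro l
        rw [sum_pow_char, map_sum]
        refine Finset.sum_congr rfl fun i _ => ?_
        rw [Algebra.smul_def, mul_pow, hd, map_mul, map_pow]
        rfl
      have hα' : algebraMap K (AlgebraicClosure K) α = (∑ i, k i • x i) ^ ringExpChar K := by
        rw [hk, hα]
        rfl
      intro l
      rw [sub_eq_zero, ← (algebraMap K (AlgebraicClosure K)).injective.eq_iff, hpow, hα']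
      refine (frobenius_inj (AlgebraicClosure K) (ringExpChar K)).eq_iff.trans ?_
      constructor
      · intro h
        exact hx.fintypeLinearCombination_injective
          (by simpa [Fintype.linearCombination_apply] using h)
      · rintro rfl
        rfl
    have hkD : ∀ i, k i ∈ D := by
      refine mem_existentialDcl_of_forall_eq
        (IsDiophantine.setOf_aeval_eq_zero_of_mem_existentialDcl
          (c := Sum.elim (fun i => (d i : K)) ![(α : K)])
          (by simp only [Sum.forall, Sum.elim_inl, Sum.elim_inr]
              exact ⟨fun i => (d i).2, fun _ => by simpa using (mem_existentialDclSubfield.1 α.2)⟩)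
          (∑ i, X (Sum.inl i) ^ ringExpChar K * X (Sum.inr (Sum.inl i)) -
            X (Sum.inr (Sum.inr 0)))) fun l => ?_
      simpa using hiff l
    exact (Submodule.mem_span_range_iff_exists_fun D).2 ⟨fun i => ⟨k i, hkD i⟩, hk⟩

theorem lambdaClosure_subset_existentialDcl :
    (lambdaClosure (Subfield.closure B) : Set K) ⊆ existentialDcl B :=
  (isLeast_lambdaClosure (Subfield.closure B)).2 (show existentialDclSubfield B ∈ _ from
    ⟨Subfield.closure_le.2 subset_existentialDcl, existentialDclSubfield_isSeparableIn⟩)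

theorem mem_existentialAcl_of_isAlgebraic {x : K}
    (hx : IsAlgebraic (lambdaClosure (Subfield.closure B)) x) : x ∈ existentialAcl B := by
  set Λ := lambdaClosure (Subfield.closure B)
  obtain ⟨f, hf0, hf⟩ := hx
  let g := f.map (algebraMap Λ K)
  have hg0 : g ≠ 0 := (Polynomial.map_ne_zero_iff (algebraMap Λ K).injective).2 hf0
  refine ⟨{z | g.IsRoot z}, ⟨Polynomial.finite_setOfPred_isRoot hg0, ?_⟩, ?_⟩
  · rw [existentiallyDefinable_iff_isDiophantine]
    have h := IsDiophantine.setOf_aeval_eq_zero_of_mem_existentialDcl (B := B) (V := Fin 1)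
      (c := fun i : Fin (g.natDegree + 1) => g.coeff i)
      (fun i => lambdaClosure_subset_existentialDcl (by
        rw [Polynomial.coeff_map]
        exact (f.coeff i).2))
      (∑ i : Fin (g.natDegree + 1), X (Sum.inr i) * X (Sum.inl 0) ^ (i : ℕ))
    convert h using 1
    ext v
    simp only [Set.mem_ofPred_eq, Polynomial.IsRoot, map_sum, map_mul, map_pow, aeval_X,
      Sum.elim_inl, Sum.elim_inr]
    rw [Polynomial.eval_eq_sum_range,
      Fin.sum_univ_eq_sum_range (fun i => g.coeff i * v 0 ^ i) (g.natDegree + 1)]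
  · rw [Set.mem_ofPred_eq, Polynomial.IsRoot, Polynomial.eval_map_algebraMap]
    exact hf

/-- Were `x` transcendental over `Λ = Λ_K 𝔽(B)`, specialisations over `Λ` of `x` and of witnesses of
its membership in the finite definable set `A` would remain in `A`, whereas they can be chosen
to avoid all transcendental and all algebraic elements of `A`. -/
theorem IsLargeField.isAlgebraic_of_mem_existentialAcl (hK : IsLargeField K) {x : K}
    (hx : x ∈ existentialAcl B) : IsAlgebraic (lambdaClosure (Subfield.closure B)) x := by
  obtain ⟨A, ⟨hA, hAdef⟩, hxA⟩ := hx
  obtain ⟨τ, ι, _, _, p, hp⟩ := existentiallyDefinable_iff_isDiophantine.1 hAdef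
  obtain ⟨y, hy⟩ := (hp fun _ => x).1 hxA
  obtain ⟨hBΛ, hΛ⟩ := (isLeast_lambdaClosure (Subfield.closure B)).1
  set Λ := lambdaClosure (Subfield.closure B)
  by_contra hx
  -- a polynomial over `Λ` killing all elements of `A` that are algebraic over `Λ`
  obtain ⟨m, hm0, hm⟩ : ∃ m : Polynomial Λ, m ≠ 0 ∧
      ∀ a ∈ A, IsAlgebraic Λ a → Polynomial.aeval a m = 0 := by
    have hfin : {a ∈ A | IsAlgebraic Λ a}.Finite := hA.subset (Set.sep_subset _ _)
    refine ⟨∏ a ∈ hfin.toFinset, minpoly Λ a, ?_, fun a ha ha' => ?_⟩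
    · exact Finset.prod_ne_zero_iff.2 fun a ha =>
        minpoly.ne_zero (hfin.mem_toFinset.1 ha).2.isIntegral
    · rw [map_prod]
      exact Finset.prod_eq_zero (hfin.mem_toFinset.2 ⟨ha, ha'⟩) (minpoly.aeval _ _)
  have hmx : Polynomial.aeval x m ≠ 0 := fun h => hx ⟨m, hm0, h⟩
  -- inverting `m(x)` prevents `x` from being specialised to a root of `m`
  let S : Set K := insert x (insert (Polynomial.aeval x m)⁻¹ (Set.range y))
  obtain ⟨R, hSR, h, hh⟩ := hK.exists_subalgebra_algHom_of_isSeparableIn hΛ (S := S)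
    (((Set.finite_range y).insert _).insert _) (Set.mem_insert _ _)
    (A := {a ∈ A | Transcendental Λ a}) (hA.subset (Set.sep_subset _ _)) fun a ha => ha.2
  set x' : R := ⟨x, hSR (Set.mem_insert _ _)⟩ with hx'
  let y' : τ → R := fun i => ⟨y i, hSR (Or.inr (Or.inr ⟨i, rfl⟩))⟩
  let b' : B → R := fun b => algebraMap Λ R ⟨b, hBΛ (Subfield.subset_closure b.2)⟩
  have hxA' : h x' ∈ A := by
    refine (hp fun _ => h x').2 ⟨h ∘ y', fun i => ?_⟩
    have h1 : aeval (Sum.elim (Sum.elim (fun _ => x') y') b') (p i) = 0 := by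
      refine Subtype.val_injective ?_
      refine (comp_aeval_apply _ (R.val.restrictScalars ℤ) (p i)).trans ?_
      refine Eq.trans ?_ (hy i)
      congr 2
      ext ((_ | _) | _) <;> rfl
    have h2 := comp_aeval_apply (Sum.elim (Sum.elim (fun _ => x') y') b')
      (h.restrictScalars ℤ) (p i)
    rw [h1, map_zero] at h2
    rw [h2]
    congr 2
    ext ((_ | _) | b)
    · rfl
    · rfl
    · exact (h.commutes ⟨b, hBΛ (Subfield.subset_closure b.2)⟩).symm
  refine hh ⟨hxA', ?_⟩
  · intro halg
    have h1 : Polynomial.aeval x' m * ⟨(Polynomial.aeval x m)⁻¹, hSR (Or.inr (Or.inl rfl))⟩ = 1 :=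
      Subtype.val_injective (by
        rw [MulMemClass.coe_mul, ← Subalgebra.coe_val, ← Polynomial.aeval_algHom_apply]
        exact mul_inv_cancel₀ hmx)
    have h2 := congrArg h h1
    rw [map_mul, ← Polynomial.aeval_algHom_apply, hm _ hxA' halg, zero_mul, map_one] at h2
    exact zero_ne_one h2

end

end

theorem mainTheorem7 {K : Type*} [Field K] (τ : TopologicalSpace K)
    (hτ : IsHenselianTopology τ) (B : Set K) :
    ((lambdaClosure (Subfield.closure B) : Set K) ⊆ existentialDcl B ∧
      existentialDcl B ⊆ (algebraicClosure (lambdaClosure (Subfield.closure B)) K : Set K)) ∧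
    existentialAcl B = (algebraicClosure (lambdaClosure (Subfield.closure B)) K : Set K) := by
  have hK := hτ.isLargeField
  have hacl : existentialAcl B
      = (algebraicClosure (lambdaClosure (Subfield.closure B)) K : Set K) :=
    Set.Subset.antisymm (fun x hx => mem_algebraicClosure_iff.2
      (hK.isAlgebraic_of_mem_existentialAcl hx))
      fun x hx => mem_existentialAcl_of_isAlgebraic (mem_algebraicClosure_iff.1 hx)
  exact ⟨⟨lambdaClosure_subset_existentialDcl,
    existentialDcl_subset_existentialAcl.trans hacl.subset⟩, hacl⟩
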